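/- **Theorem 2 (indexability).** *Model.* A content is described by an update rate $\lambda\ge 0$, a request probability $p\in(0,1]$, an ageing cost $c_a>0$ per update, a fetching cost $c_f>0$, and the rate $\beta>0$ of the Poisson process of request epochs $t_1<t_2<\dots$; each request is for this content with probability $p$, independently. At a request epoch the state is $(\tau,1,b)$ if the content is cached and its copy was fetched $\tau\ge 0$ time units ago, and $(0,b)$ if it is not cached, where $b\in\{0,1\}$ indicates whether the request is for this content. The actions are $0$ (keep the cached copy, serving it if requested), $1$ (fetch, serve and cache), $2$ (discard the cached copy, after serving it if requested), $3$ (fetch, serve and discard). The available actions are $\{0,1,2,3\}$ in $(\tau,1,1)$, $\{0,2\}$ in $(\tau,1,0)$, $\{1,3\}$ in $(0,1)$; in $(0,0)$ no action is taken. With $\Delta\sim\mathrm{Exp}(\beta)$ and $b'\sim\mathrm{Bernoulli}(p)$ independent of each other and of the past, the next state is $(\tau+\Delta,1,b')$ after action $0$, $(\Delta,1,b')$ after action $1$, and $(0,b')$ after actions $2,3$ and from $(0,0)$. For a holding cost $C_h\ge 0$ per unit of time, the stage cost $c(s,a)$ is $\frac{C_h}{\beta}\mathbf 1_{\{a\in\{0,1\}\}}$,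 plus $c_f$ if $a\in\{1,3\}$, plus $c_a\lambda\tau$ if $s=(\tau,1,1)$ and $a\in\{0,2\}$. With $A(T)$ the number of request epochs up to time $T$, the average cost of a policy $\pi=(\mu_0,\mu_1,\dots)$, $a_k=\mu_k(s_k)$, is $J_\pi(s)=\limsup_{T\to\infty}\mathbb E_\pi[\sum_{k=1}^{A(T)}c(s_k,a_k)\mid s_0=s]/\mathbb E[A(T)]$. An optimal policy $\pi^*_{C_h}$ is a stationary policy that attains $\inf_\pi J_\pi(s)$ for every $s$ and that in every state takes an action attaining the minimum in Bellman's equation $$h(s)=\min_a\Big\{c(s,a)-\frac{\theta}{\beta}+\mathbb E[h(s')\mid s,a]\Big\}$$ for a real $\theta$ and a bounded measurable $h$ (with zero cost and the single possible transition in $(0,0)$). Its passive set is $\mathcal P(C_h)=\{s:\pi^*_{C_h}(s)\in\{2,3\}\}$. *Claim.* The single-content problem is indexable: an optimal policy exists for every $C_h\ge 0$, and for every choice of optimal policies $\pi^*_{C_h}$, $C_h\ge0$, such that $\pi^*_0$ takes an action in $\{0,1\}$ in every state in which some such action attains the minimum in Bellman's equation for $C_h=0$ (ties may be resolved in any way for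 $C_h>0$), (a) $\mathcal P(0)=\emptyset$, and for all sufficiently large $C_h$ the set $\mathcal P(C_h)$ consists of all states in which an action is taken, that is, all states except $(0,0)$; (b) $\mathcal P(C_1)\subseteq\mathcal P(C_2)$ whenever $0\le C_1\le C_2$. Hence the caching restless multi-armed bandit with $N$ contents, with update rates $\lambda_n\ge0$, request probabilities $p_n>0$, $\sum_n p_n=1$, and common $\beta,c_a,c_f>0$, is indexable, i.e. the single-content problem of every content $n$ is indexable. -/

import Mathlib

open MeasureTheory ProbabilityTheory Filter
open scoped ENNReal NNReal

noncomputable section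

namespace Caching

/-- State of one content at a request epoch. `Sum.inl (τ, b)`: the content is cached and its copy was
fetched `τ` time units ago (the state `(τ, 1, b)`). `Sum.inr b`: the content is not cached (the state
`(0, b)`). In both cases `b` tells whether the current request is for this content. -/
abbrev State : Type := (ℝ≥0 × Bool) ⊕ Bool

/-- The actions `0, 1, 2, 3`, in this order, and `idle`, which stands for "no action is taken". -/
inductive Action : Type
  | keep
  | fetchKeep
  | discard
  | fetchDiscard
  | idle

instance : MeasurableSpace Action := ⊤

/-- The actions available in each state; in the state `(0, 0)` no action is taken. -/
def admissible : State → Set Action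
  | Sum.inl (_, true) => {.keep, .fetchKeep, .discard, .fetchDiscard}
  | Sum.inl (_, false) => {.keep, .discard}
  | Sum.inr true => {.fetchKeep, .fetchDiscard}
  | Sum.inr false => {.idle}

/-- The states in which an action is taken, that is, all states except `(0, 0)`. -/
def actionStates : Set State := {s | s ≠ Sum.inr false}

/-- The active actions `0` and `1`: the content is in the cache after the epoch. -/
def activeActions : Set Action := {.keep, .fetchKeep}

/-- The passive actions `2` and `3`: the content is discarded. -/
def passiveActions : Set Action := {.discard, .fetchDiscard}

/-- A measurable decision rule choosing an available action in every state; it is also used as a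
stationary policy. -/
structure DecisionRule where
  act : State → Action
  act_mem : ∀ s, act s ∈ admissible s
  measurable_act : Measurable act

/-- The next state, given the current state, the action, the time `x.1` until the next request epoch,
and the indicator `x.2` that the next request is for this content. -/
def next : State → Action → ℝ≥0 × Bool → State
  | Sum.inl (τ, _), .keep, x => Sum.inl (τ + x.1, x.2)
  | _, .fetchKeep, x => Sum.inl x
  | _, _, x => Sum.inr x.2

/-- The state at the `k`-th request epoch under the policy `π = (μ₀, μ₁, …)`, started in `s` at
time `0`, when `ω k` is the pair (time from epoch `k` to epoch `k + 1`, request indicator at epoch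
`k + 1`). -/
def stateAt (π : ℕ → DecisionRule) (s : State) (ω : ℕ → ℝ≥0 × Bool) : ℕ → State
  | 0 => s
  | k + 1 => next (stateAt π s ω k) ((π k).act (stateAt π s ω k)) (ω k)

/-- The time `t_k` of the `k`-th request epoch (`t_0 = 0`). -/
def epoch (ω : ℕ → ℝ≥0 × Bool) (k : ℕ) : ℝ := ∑ j ∈ Finset.range k, ((ω j).1 : ℝ)

/-- The sum `∑_{k = 1}^{A(T)} f k`, where `A(T)` is the number of request epochs `t_1 ≤ t_2 ≤ …` up to
time `T`. -/
def sumUpTo (ω : ℕ → ℝ≥0 × Bool) (T : ℝ) (f : ℕ → ℝ≥0∞) : ℝ≥0∞ :=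
  ∑' k : ℕ, Set.indicator {k | 1 ≤ k ∧ epoch ω k ≤ T} f k

/-- The data of a single content: update rate `lam`, probability `p` that a request is for this
content, rate `β` of the aggregate Poisson request process, ageing cost `ca` per update, fetching
cost `cf`. -/
structure Content where
  lam : ℝ
  p : ℝ
  β : ℝ
  ca : ℝ
  cf : ℝ
  lam_nonneg : 0 ≤ lam
  p_pos : 0 < p
  p_le_one : p ≤ 1
  β_pos : 0 < β
  ca_pos : 0 < ca
  cf_pos : 0 < cf

namespace Content

variable (X : Content)

/-- The law of (time to the next epoch, request indicator): exponential of rate `β`, times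
Bernoulli of parameter `p`. -/
def noise : Measure (ℝ≥0 × Bool) :=
  ((expMeasure X.β).map Real.toNNReal).prod
    (ENNReal.ofReal X.p • Measure.dirac true + ENNReal.ofReal (1 - X.p) • Measure.dirac false)

instance : IsProbabilityMeasure X.noise := by
  have := isProbabilityMeasure_expMeasure X.β_pos
  have : IsProbabilityMeasure ((expMeasure X.β).map Real.toNNReal) :=
    Measure.isProbabilityMeasure_map measurable_real_toNNReal.aemeasurable
  have : IsProbabilityMeasure (ENNReal.ofReal X.p • Measure.dirac true +
      ENNReal.ofReal (1 - X.p) • Measure.dirac false : Measure Bool) := ⟨by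
    have h := X.p_le_one
    simp only [Measure.coe_add, Measure.coe_smul, Pi.add_apply, Pi.smul_apply, measure_univ,
      smul_eq_mul, mul_one]
    rw [← ENNReal.ofReal_add X.p_pos.le (by linarith)]
    simp⟩
  unfold noise
  infer_instance

/-- The law of the whole driving sequence: independent copies of `noise`. -/
def law : Measure (ℕ → ℝ≥0 × Bool) := Measure.infinitePi fun _ => X.noise

/-- The expected single-stage cost `c(s, a)` under the holding cost `Ch` per unit of time. -/
def cost (Ch : ℝ) : State → Action → ℝ
  | Sum.inl (τ, true), .keep => X.ca * X.lam * τ + Ch / X.β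
  | Sum.inl (_, true), .fetchKeep => X.cf + Ch / X.β
  | Sum.inl (τ, true), .discard => X.ca * X.lam * τ
  | Sum.inl (_, true), .fetchDiscard => X.cf
  | Sum.inl (_, false), .keep => Ch / X.β
  | Sum.inr true, .fetchKeep => X.cf + Ch / X.β
  | Sum.inr true, .fetchDiscard => X.cf
  | _, _ => 0

/-- The average cost `J_π(s)`: the upper limit, as `T → ∞`, of
`E[∑_{k = 1}^{A(T)} c(s_k, a_k)] / E[A(T)]` with `a_k = μ_k(s_k)` and `s_0 = s`. -/
def avgCost (Ch : ℝ) (π : ℕ → DecisionRule) (s : State) : ℝ≥0∞ :=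
  limsup (fun T : ℝ =>
    (∫⁻ ω, sumUpTo ω T (fun k =>
        ENNReal.ofReal (X.cost Ch (stateAt π s ω k) ((π k).act (stateAt π s ω k)))) ∂X.law) /
      (∫⁻ ω, sumUpTo ω T (fun _ => 1) ∂X.law)) atTop

/-- The optimal average cost `J_*(s)`. -/
def optCost (Ch : ℝ) (s : State) : ℝ≥0∞ := ⨅ π : ℕ → DecisionRule, X.avgCost Ch π s

/-- The expression minimized on the right-hand side of Bellman's equation:
`c(s, a) - θ / β + E[h(next state)]`. -/
def bellmanValue (Ch θ : ℝ) (h : State → ℝ) (s : State) (a : Action) : ℝ :=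
  X.cost Ch s a - θ / X.β + ∫ x, h (next s a x) ∂X.noise

/-- `(θ, h)` solves Bellman's equation of the average-cost semi-Markov problem with a bounded
measurable relative value function `h`. -/
def IsBellmanSolution (Ch θ : ℝ) (h : State → ℝ) : Prop :=
  Measurable h ∧ (∃ B : ℝ, ∀ s, |h s| ≤ B) ∧
    ∀ s, IsLeast (X.bellmanValue Ch θ h s '' admissible s) (h s)

/-- `a` is an optimal action in state `s`: it attains the minimum in Bellman's equation. -/
def IsOptimalAction (Ch : ℝ) (s : State) (a : Action) : Prop :=
  a ∈ admissible s ∧ ∃ (θ : ℝ) (h : State → ℝ), X.IsBellmanSolution Ch θ h ∧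
    X.bellmanValue Ch θ h s a = h s

/-- `μ` is an optimal stationary policy `π*` for the holding cost `Ch`: it attains the optimal
average cost from every initial state, and in every state it takes an action attaining the minimum
in Bellman's equation. (The average cost alone does not determine the actions in transient
states.) -/
def IsOptimalPolicy (Ch : ℝ) (μ : DecisionRule) : Prop :=
  (∀ s, X.avgCost Ch (fun _ => μ) s = X.optCost Ch s) ∧
    ∃ (θ : ℝ) (h : State → ℝ), X.IsBellmanSolution Ch θ h ∧
      ∀ s, X.bellmanValue Ch θ h s (μ.act s) = h s

/-- A choice of an optimal policy for each holding cost `Ch ≥ 0`, such that ties between keeping and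
discarding are resolved in favour of keeping when `Ch = 0`. For `Ch > 0` ties may be resolved in
any way. -/
def IsOptimalFamily (μ : ℝ → DecisionRule) : Prop :=
  (∀ Ch, 0 ≤ Ch → X.IsOptimalPolicy Ch (μ Ch)) ∧
    ∀ s, (∃ a ∈ activeActions, X.IsOptimalAction 0 s a) → (μ 0).act s ∈ activeActions

end Content

/-- The passive set of a policy: the states in which it discards the content. -/
def passiveSet (μ : DecisionRule) : Set State := {s | μ.act s ∈ passiveActions}

namespace Content

/-- The single-content problem is indexable: optimal policies exist for all holding costs
`Ch ≥ 0`, and, whichever are chosen, the passive set `P(Ch)` is empty for `Ch = 0`, consists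
of all states in which an action is taken for all large `Ch`, and is nondecreasing in `Ch`. -/
def Indexable (X : Content) : Prop :=
  (∃ μ : ℝ → DecisionRule, X.IsOptimalFamily μ) ∧
    ∀ μ : ℝ → DecisionRule, X.IsOptimalFamily μ →
      passiveSet (μ 0) = ∅ ∧
      (∃ C₀ : ℝ, 0 ≤ C₀ ∧ ∀ Ch, C₀ ≤ Ch → passiveSet (μ Ch) = actionStates) ∧
      ∀ C₁ C₂, 0 ≤ C₁ → C₁ ≤ C₂ → passiveSet (μ C₁) ⊆ passiveSet (μ C₂)

end Content

/-- The data of the caching restless bandit with `N` contents and cache capacity `M`. The capacity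
enters only the constraint that couples the contents, not the single-content problems. -/
structure CachingRMAB (N M : ℕ) where
  lam : Fin N → ℝ
  p : Fin N → ℝ
  β : ℝ
  ca : ℝ
  cf : ℝ
  lam_nonneg : ∀ n, 0 ≤ lam n
  p_pos : ∀ n, 0 < p n
  p_sum : ∑ n, p n = 1
  β_pos : 0 < β
  ca_pos : 0 < ca
  cf_pos : 0 < cf

namespace CachingRMAB

variable {N M : ℕ}

/-- The arm of content `n`, that is, its single-content problem. -/
def content (R : CachingRMAB N M) (n : Fin N) : Content where
  lam := R.lam n
  p := R.p n
  β := R.β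
  ca := R.ca
  cf := R.cf
  lam_nonneg := R.lam_nonneg n
  p_pos := R.p_pos n
  p_le_one := R.p_sum ▸ Finset.single_le_sum (fun i _ => (R.p_pos i).le) (Finset.mem_univ n)
  β_pos := R.β_pos
  ca_pos := R.ca_pos
  cf_pos := R.cf_pos

/-- The restless bandit is indexable: every single-content problem is indexable. -/
def Indexable (R : CachingRMAB N M) : Prop := ∀ n, (R.content n).Indexable

end CachingRMAB

end Caching

end

noncomputable section

namespace Caching

/-! Normalize a solution of Bellman's equation to vanish in (0,0). Let `z` be its value in (0,1),
let `u τ` be its value in (τ,1,0), and let c = C_h/β. The equation in (0,0) gives θ/β = p z. What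
remains is the scalar system `IsReducedSolution`: u = min(f, 0) and z = c_f + u(0). Here the
advantage f(τ) is the cost of keeping a copy of age τ minus the cost of discarding it.

In every state the passive actions have costs free of c, z and u, while each active action has such
a cost plus one value of f. Indexability therefore reduces to strict monotonicity of f in c
(`advantage_lt`): a passive action that is optimal at c excludes an optimal active action at any c'
> c. Because the monotonicity is strict and holds between arbitrary solutions, ties need no rule and
solutions need not be unique. At c = 0 one has f ≤ 0, and for c > p c_f one has f > 0; these give
the two extreme passive sets.

Monotonicity is a maximum principle in the form of `nonpos_of_improvable`: a positive bound on a
difference of solutions reproduces itself with a strictly smaller value. First p(z' - z) ≤ c' - c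
(`fetch_sub_le`). With ageing, gaps long enough to make any copy obsolete have positive probability
and supply the contraction. Without ageing there is no such contraction. There f is computed
explicitly, using that bounded harmonic functions of the exponential random walk are constant
(`harmonic_const`).

Optimal policies exist because the reduced system is solvable (value iteration for fixed z, then the
intermediate value theorem in z) and because a drift inequality up to time T turns a bounded
solution of Bellman's equation into matching bounds on the average cost. -/

/-- A function bounded above is nonpositive if each of its positive upper bounds can be lowered. -/
lemma nonpos_of_improvable {α : Type*} {D : α → ℝ} (hD : BddAbove (Set.range D))
    (H : ∀ e, 0 < e → (∀ a, D a ≤ e) → ∃ e' < e, ∀ a, D a ≤ e') (a : α) : D a ≤ 0 := by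
  by_contra! ha
  have : Nonempty α := ⟨a⟩
  obtain ⟨e', he', h⟩ := H (⨆ b, D b) (ha.trans_le (le_ciSup hD a)) (le_ciSup hD)
  exact absurd (ciSup_le h) (not_le.2 he')

/-! ### The exponential time between request epochs. -/

namespace Content

variable (X : Content)

/-- The law of the time between two request epochs. -/
def gap : Measure ℝ≥0 := (expMeasure X.β).map Real.toNNReal

instance : IsProbabilityMeasure X.gap := by
  have := isProbabilityMeasure_expMeasure X.β_pos
  exact Measure.isProbabilityMeasure_map measurable_real_toNNReal.aemeasurable

lemma integrable_gap {F : ℝ≥0 → ℝ} (hF : Measurable F) {B : ℝ} (hB : ∀ x, |F x| ≤ B) :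
    Integrable F X.gap :=
  Integrable.of_bound hF.aestronglyMeasurable B (.of_forall hB)

lemma integrable_noise {F : ℝ≥0 × Bool → ℝ} (hF : Measurable F) {B : ℝ} (hB : ∀ x, |F x| ≤ B) :
    Integrable F X.noise :=
  Integrable.of_bound hF.aestronglyMeasurable B (.of_forall hB)

lemma integral_noise {F : ℝ≥0 × Bool → ℝ} (hF : Measurable F) {B : ℝ} (hB : ∀ x, |F x| ≤ B) :
    ∫ x, F x ∂X.noise = ∫ x, (X.p * F (x, true) + (1 - X.p) * F (x, false)) ∂X.gap := by
  have := isProbabilityMeasure_expMeasure X.β_pos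
  have : IsProbabilityMeasure ((expMeasure X.β).map Real.toNNReal) :=
    Measure.isProbabilityMeasure_map measurable_real_toNNReal.aemeasurable
  have hi := X.integrable_noise hF hB
  have h1 := X.p_le_one
  rw [noise] at hi ⊢
  rw [integral_prod _ hi]
  refine integral_congr_ae (.of_forall fun x => ?_)
  dsimp only
  rw [integral_add_measure ((integrable_dirac (by simp)).smul_measure ENNReal.ofReal_ne_top)
    ((integrable_dirac (by simp)).smul_measure ENNReal.ofReal_ne_top), integral_smul_measure,
    integral_smul_measure, integral_dirac, integral_dirac,
    ENNReal.toReal_ofReal X.p_pos.le, ENNReal.toReal_ofReal (by linarith), smul_eq_mul, smul_eq_mul]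

lemma integral_noise_snd (F : Bool → ℝ) :
    ∫ x, F x.2 ∂X.noise = X.p * F true + (1 - X.p) * F false := by
  rw [X.integral_noise (F := fun x => F x.2) (by fun_prop) (B := |F true| + |F false|)]
  · simp
  · rintro ⟨x, _ | _⟩ <;> simp

lemma lintegral_noise_fst {F : ℝ≥0 → ℝ≥0∞} (hF : Measurable F) :
    ∫⁻ x, F x.1 ∂X.noise = ∫⁻ x, F x ∂X.gap := by
  have h1 := X.p_le_one
  have : IsProbabilityMeasure (ENNReal.ofReal X.p • Measure.dirac true +
      ENNReal.ofReal (1 - X.p) • Measure.dirac false : Measure Bool) := ⟨by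
    simp only [Measure.coe_add, Measure.coe_smul, Pi.add_apply, Pi.smul_apply, measure_univ,
      smul_eq_mul, mul_one]
    rw [← ENNReal.ofReal_add X.p_pos.le (by linarith)]
    simp⟩
  rw [← lintegral_map hF measurable_fst]
  congr 1
  rw [noise, ← Measure.fst, Measure.fst_prod, gap]

/-- Long times between request epochs have positive probability. -/
lemma gap_Ici_pos (S : ℝ≥0) : 0 < X.gap.real (Set.Ici S) := by
  have := isProbabilityMeasure_expMeasure X.β_pos
  have h := cdf_expMeasure_eq X.β_pos S
  rw [if_pos S.coe_nonneg, cdf_eq_real] at h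
  have h2 : X.gap.real (Set.Ici S) = (expMeasure X.β).real (Real.toNNReal ⁻¹' Set.Ici S) := by
    rw [gap, map_measureReal_apply measurable_real_toNNReal measurableSet_Ici]
  rw [h2]
  refine lt_of_lt_of_le ?_ (measureReal_mono (s₁ := (Set.Iic (S : ℝ))ᶜ) ?_)
  · rw [probReal_compl_eq_one_sub measurableSet_Iic, h]
    have := Real.exp_pos (-(X.β * S))
    linarith
  · intro x hx
    simp only [Set.mem_compl_iff, Set.mem_Iic, not_le] at hx
    exact NNReal.le_toNNReal_of_coe_le hx.le

lemma integral_gap_eq {F : ℝ≥0 → ℝ} (hF : Measurable F) :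
    ∫ x, F x ∂X.gap = ∫ x in Set.Ioi (0 : ℝ), X.β * Real.exp (-(X.β * x)) * F x.toNNReal := by
  rw [gap, integral_map measurable_real_toNNReal.aemeasurable hF.aestronglyMeasurable, expMeasure,
    gammaMeasure]
  have h : gammaPDF 1 X.β = fun x => ENNReal.ofReal (exponentialPDFReal X.β x) := rfl
  rw [h]
  rw [integral_withDensity_eq_integral_toReal_smul (by fun_prop) (by simp)]
  rw [← setIntegral_eq_integral_of_forall_compl_eq_zero (s := Set.Ici 0), integral_Ici_eq_integral_Ioi]
  · refine setIntegral_congr_fun measurableSet_Ioi fun x hx => ?_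
    have hx' : (0 : ℝ) ≤ x := le_of_lt hx
    rw [ENNReal.toReal_ofReal (exponentialPDFReal_nonneg X.β_pos x), smul_eq_mul,
      exponentialPDFReal, gammaPDFReal, if_pos hx']
    simp
  · intro x hx
    have hx' : ¬ (0 : ℝ) ≤ x := hx
    rw [exponentialPDFReal, gammaPDFReal, if_neg hx']
    simp

/-- The lack of memory of the time between two request epochs. -/
lemma integral_gap_add {F : ℝ≥0 → ℝ} (hF : Measurable F) {B : ℝ} (hB : ∀ x, |F x| ≤ B) (t : ℝ≥0) :
    ∫ x, F x ∂X.gap = ∫ x in Set.Iio t, F x ∂X.gap +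
      Real.exp (-(X.β * t)) * ∫ x, F (t + x) ∂X.gap := by
  have hi := X.integrable_gap hF hB
  rw [← integral_add_compl (measurableSet_Iio (a := t)) hi]
  congr 1
  have hc : (Set.Iio t)ᶜ = Set.Ici t := by ext; simp
  rw [hc, ← integral_indicator measurableSet_Ici,
    X.integral_gap_eq (hF.indicator measurableSet_Ici), X.integral_gap_eq (F := fun x => F (t + x))
      (by fun_prop), ← integral_const_mul]
  have key : ∫ x in Set.Ioi (0 : ℝ), X.β * Real.exp (-(X.β * x)) *
      (Set.Ici t).indicator F x.toNNReal =
      ∫ x in Set.Ioi (t : ℝ), X.β * Real.exp (-(X.β * x)) * F x.toNNReal := by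
    rw [← integral_Ici_eq_integral_Ioi (x := (t : ℝ)),
      ← integral_indicator measurableSet_Ici, ← integral_indicator measurableSet_Ioi]
    refine integral_congr_ae ?_
    filter_upwards [compl_mem_ae_iff.2 (measure_singleton (0 : ℝ))] with x hx
    have hx0 : x ≠ 0 := hx
    by_cases h : (t : ℝ) ≤ x
    · have hx1 : 0 < x := lt_of_le_of_ne (t.2.trans h) hx0.symm
      rw [Set.indicator_of_mem (show x ∈ Set.Ioi 0 from hx1), Set.indicator_of_mem
        (show x ∈ Set.Ici (t : ℝ) from h), Set.indicator_of_mem]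
      exact NNReal.le_toNNReal_of_coe_le h
    · rw [Set.indicator_of_notMem (s := Set.Ici (t : ℝ)) h]
      refine Set.indicator_apply_eq_zero.2 fun hx1 => ?_
      rw [Set.indicator_of_notMem, mul_zero]
      intro h'
      exact h ((Real.le_toNNReal_iff_coe_le (le_of_lt hx1)).1 h')
  rw [key]
  have hm : MeasurePreserving (fun x : ℝ => (t : ℝ) + x) volume volume :=
    measurePreserving_add_left volume (t : ℝ)
  have he : MeasurableEmbedding (fun x : ℝ => (t : ℝ) + x) :=
    (MeasurableEquiv.addLeft (t : ℝ)).measurableEmbedding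
  have hp : (fun x : ℝ => (t : ℝ) + x) ⁻¹' Set.Ioi (t : ℝ) = Set.Ioi 0 := by ext; simp
  rw [← hm.setIntegral_preimage_emb he, hp]
  refine setIntegral_congr_fun measurableSet_Ioi fun x hx => ?_
  have hx' : (0 : ℝ) ≤ x := le_of_lt hx
  rw [Real.toNNReal_add t.coe_nonneg hx', Real.toNNReal_coe, mul_add, neg_add, Real.exp_add]
  ring

/-- Bounded harmonic functions of the random walk of request epochs are constant. -/
lemma harmonic_const {u : ℝ≥0 → ℝ} (hu : Measurable u) {B : ℝ} (hB : ∀ x, |u x| ≤ B)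
    (h : ∀ t, u t = ∫ x, u (t + x) ∂X.gap) (t : ℝ≥0) : u t = u 0 := by
  have hB0 : 0 ≤ B := (abs_nonneg _).trans (hB 0)
  have hbd : BddAbove (Set.range fun y : Set.Iic t => |u y - u t|) := by
    refine ⟨2 * B, ?_⟩
    rintro _ ⟨y, rfl⟩
    have := abs_sub (u y) (u t)
    have := hB y
    have := hB t
    dsimp only
    linarith
  have key := nonpos_of_improvable hbd (fun e he hD => ⟨(1 - Real.exp (-(X.β * t))) * e, ?_, ?_⟩)
    ⟨0, Set.mem_Iic.2 zero_le⟩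
  · have := abs_nonpos_iff.1 key
    simp only at this
    linarith
  · nlinarith [Real.exp_pos (-(X.β * t))]
  · rintro ⟨y, hy⟩
    -- Write t = y + r. Then u(y) - u(t) is the mean of u(y + Δ) - u(t). By lack of memory the part
    -- with Δ ≥ r is a multiple of E[u(t + Δ)] - u(t) = 0. Only Δ < r remains; its probability is at
    -- most 1 - exp(-β t), and y + Δ stays in [0, t].
    obtain ⟨r, rfl⟩ := exists_add_of_le (show y ≤ t from hy)
    dsimp only
    have hF : Measurable fun x => u (y + x) - u (y + r) := by fun_prop
    have hFB : ∀ x, |u (y + x) - u (y + r)| ≤ 2 * B := fun x => by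
      have := abs_sub (u (y + x)) (u (y + r))
      have := hB (y + x)
      have := hB (y + r)
      linarith
    have hint : ∀ a b, ∫ x, (u (a + x) - b) ∂X.gap = u a - b := fun a b => by
      rw [integral_sub (X.integrable_gap (by fun_prop) (fun x => hB (a + x)))
        (integrable_const _), ← h]
      simp
    have hone := X.integral_gap_add (F := fun _ => (1 : ℝ)) (by fun_prop) (B := 1) (by simp) r
    simp only [integral_const, probReal_univ, smul_eq_mul, mul_one, MeasurableSet.univ,
      measureReal_restrict_apply, Set.univ_inter] at hone
    have h2 := X.integral_gap_add hF hFB r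
    simp_rw [← add_assoc] at h2
    rw [hint y, hint (y + r), sub_self, mul_zero, add_zero] at h2
    rw [h2]
    have h3 : ‖∫ x in Set.Iio r, (u (y + x) - u (y + r)) ∂X.gap‖ ≤ e * X.gap.real (Set.Iio r) :=
      norm_setIntegral_le_of_norm_le_const (measure_lt_top _ _)
        (fun x hx => hD ⟨y + x, by
          have : x < r := hx
          exact add_le_add_right this.le y⟩)
    have h4 : Real.exp (-(X.β * ((y + r : ℝ≥0) : ℝ))) ≤ Real.exp (-(X.β * r)) := by
      apply Real.exp_le_exp.2
      have := mul_nonneg X.β_pos.le y.coe_nonneg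
      push_cast
      linarith [mul_add X.β (y : ℝ) r]
    rw [Real.norm_eq_abs] at h3
    nlinarith

/-- The integrand is at most 1, and at most exp(-1) on the event Δ ≥ 1, which has positive
probability. This discount factor later bounds the expected number of epochs. -/
lemma lintegral_exp_neg_lt_one : ∫⁻ x, ENNReal.ofReal (Real.exp (-(x : ℝ))) ∂X.gap < 1 := by
  have hm : Measurable fun x : ℝ≥0 => Real.exp (-(x : ℝ)) := by fun_prop
  have hb : ∀ x : ℝ≥0, |Real.exp (-(x : ℝ))| ≤ 1 := fun x => by
    rw [abs_of_pos (Real.exp_pos _), Real.exp_le_one_iff]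
    simp
  rw [← ofReal_integral_eq_lintegral_ofReal (X.integrable_gap hm hb)
    (.of_forall fun x => (Real.exp_pos _).le), ENNReal.ofReal_lt_one]
  have hq := X.gap_Ici_pos 1
  have hi : Integrable ((Set.Ici (1 : ℝ≥0)).indicator fun _ => 1 - Real.exp (-1)) X.gap :=
    (integrable_const _).indicator measurableSet_Ici
  have h : ∫ x, Real.exp (-(x : ℝ)) ∂X.gap ≤
      ∫ x, (1 - (Set.Ici (1 : ℝ≥0)).indicator (fun _ => 1 - Real.exp (-1)) x) ∂X.gap := by
    refine integral_mono (X.integrable_gap hm hb) ((integrable_const _).sub hi) fun x => ?_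
    by_cases hx : 1 ≤ x
    · simp only [Set.mem_Ici, hx, Set.indicator_of_mem, sub_sub_cancel]
      exact Real.exp_le_exp.2 (neg_le_neg (by exact_mod_cast hx))
    · simp only [Set.mem_Ici, hx, not_false_eq_true, Set.indicator_of_notMem, sub_zero]
      exact (abs_le.1 (hb x)).2
  rw [integral_sub (integrable_const _) hi, integral_indicator measurableSet_Ici] at h
  simp only [integral_const, probReal_univ, smul_eq_mul, mul_one, MeasurableSet.univ,
    measureReal_restrict_apply, Set.univ_inter] at h
  have h1 : Real.exp (-1) < 1 := by rw [Real.exp_lt_one_iff]; norm_num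
  nlinarith

end Content

/-! ### The reduced Bellman equation and comparison of its solutions. -/

namespace Content

variable (X : Content)

/-- The expected ageing cost per unit of age at a request. -/
def ageing : ℝ := X.ca * X.lam

lemma ageing_nonneg : 0 ≤ X.ageing := mul_nonneg X.ca_pos.le X.lam_nonneg

/-- The expected value, relative to an empty cache, of arriving at a request epoch with a copy of
age `s`, if serving the request by a fetch costs `z` and `u` is the value of the copy after the
request. -/
def gain (z : ℝ) (u : ℝ≥0 → ℝ) (s : ℝ≥0) : ℝ :=
  X.p * min (X.ageing * s + u s - z) 0 + (1 - X.p) * u s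

/-- The cost of keeping a copy of age `τ` minus the cost of discarding it. -/
def advantage (c z : ℝ) (u : ℝ≥0 → ℝ) (τ : ℝ≥0) : ℝ := c + ∫ x, X.gain z u (τ + x) ∂X.gap

variable {X}

@[fun_prop]
lemma measurable_gain {z : ℝ} {u : ℝ≥0 → ℝ} (hu : Measurable u) : Measurable (X.gain z u) := by
  unfold gain
  fun_prop

lemma abs_gain_le {z B : ℝ} {u : ℝ≥0 → ℝ} (hB : ∀ s, |u s| ≤ B) (s : ℝ≥0) :
    |X.gain z u s| ≤ B + |z| := by
  have h0 := X.p_pos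
  have h1 := X.p_le_one
  have hs := mul_nonneg X.ageing_nonneg s.coe_nonneg
  obtain ⟨h2, h3⟩ := abs_le.1 (hB s)
  have h4 := neg_abs_le z
  have h5 := le_abs_self z
  have h6 : -(B + |z|) ≤ min (X.ageing * s + u s - z) 0 := le_min (by linarith) (by linarith)
  have h7 : min (X.ageing * s + u s - z) 0 ≤ 0 := min_le_right _ _
  have h8 : 0 ≤ |z| := abs_nonneg z
  unfold gain
  rw [abs_le]
  constructor <;> nlinarith

lemma integrable_gain {z B : ℝ} {u : ℝ≥0 → ℝ} (hu : Measurable u) (hB : ∀ s, |u s| ≤ B) (τ : ℝ≥0) :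
    Integrable (fun x => X.gain z u (τ + x)) X.gap :=
  X.integrable_gap (by fun_prop) (fun x => abs_gain_le hB (τ + x))

lemma measurable_advantage {c z : ℝ} {u : ℝ≥0 → ℝ} (hu : Measurable u) :
    Measurable (X.advantage c z u) := by
  unfold advantage
  refine measurable_const.add (StronglyMeasurable.integral_prod_right ?_).measurable
  exact (show Measurable fun q : ℝ≥0 × ℝ≥0 => X.gain z u (q.1 + q.2) by fun_prop).stronglyMeasurable

/-- The extra saving `l` on ages beyond `S` is collected whenever the gap itself is at least `S`,
whatever the starting age. Its weight P(Δ ≥ S) is therefore uniform in `τ`, which is what makes the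
comparisons contract. -/
lemma advantage_le {c c' z z' B B' k l : ℝ} {u u' : ℝ≥0 → ℝ} (hu : Measurable u)
    (hu' : Measurable u') (hB : ∀ s, |u s| ≤ B) (hB' : ∀ s, |u' s| ≤ B') (S : ℝ≥0)
    (h : ∀ s, X.gain z u s ≤ X.gain z' u' s + k)
    (hS : ∀ s, S ≤ s → X.gain z u s ≤ X.gain z' u' s + k - l) (τ : ℝ≥0) :
    X.advantage c z u τ ≤ X.advantage c' z' u' τ + (c - c') + k - l * X.gap.real (Set.Ici S) := by
  have hi : Integrable ((Set.Ici S).indicator fun _ => l) X.gap :=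
    (integrable_const _).indicator measurableSet_Ici
  have hi' := integrable_gain (X := X) (z := z') hu' hB' τ
  have hik : Integrable (fun x => X.gain z' u' (τ + x) + k) X.gap := hi'.add (integrable_const k)
  have key : ∫ x, X.gain z u (τ + x) ∂X.gap ≤
      ∫ x, (X.gain z' u' (τ + x) + k - (Set.Ici S).indicator (fun _ => l) x) ∂X.gap := by
    refine integral_mono (integrable_gain hu hB τ) (hik.sub hi)
      fun x => ?_
    by_cases hx : S ≤ x
    · rw [Set.indicator_of_mem (show x ∈ Set.Ici S from hx)]
      exact hS _ (hx.trans le_add_self)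
    · rw [Set.indicator_of_notMem (show x ∉ Set.Ici S from hx), sub_zero]
      exact h _
  rw [integral_sub hik hi, integral_add hi' (integrable_const k),
    integral_indicator measurableSet_Ici] at key
  simp only [integral_const, probReal_univ, smul_eq_mul, one_mul, MeasurableSet.univ,
    measureReal_restrict_apply, Set.univ_inter] at key
  unfold advantage
  linarith

lemma advantage_le_of_gain_le {c c' z z' B B' k : ℝ} {u u' : ℝ≥0 → ℝ} (hu : Measurable u)
    (hu' : Measurable u') (hB : ∀ s, |u s| ≤ B) (hB' : ∀ s, |u' s| ≤ B')
    (h : ∀ s, X.gain z u s ≤ X.gain z' u' s + k) (τ : ℝ≥0) :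
    X.advantage c z u τ ≤ X.advantage c' z' u' τ + (c - c') + k := by
  simpa using advantage_le (l := 0) hu hu' hB hB' 0 h (by simpa using h) τ

variable (X)

/-- The reduced Bellman equation: `u τ` is the value of a copy of age `τ` relative to an empty cache
and `z` is the relative cost of a request when nothing is cached; `c` is the holding cost per stage. -/
structure IsReducedSolution (c z : ℝ) (u : ℝ≥0 → ℝ) : Prop where
  measurable : Measurable u
  bounded : ∃ B, ∀ τ, |u τ| ≤ B
  eq_min : ∀ τ, u τ = min (X.advantage c z u τ) 0
  fetch_eq : z = X.cf + u 0

variable {X}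

namespace IsReducedSolution

variable {c z : ℝ} {u : ℝ≥0 → ℝ}

lemma nonpos (h : X.IsReducedSolution c z u) (τ : ℝ≥0) : u τ ≤ 0 := by
  rw [h.eq_min]
  exact min_le_right _ _

lemma le_advantage (h : X.IsReducedSolution c z u) (τ : ℝ≥0) : u τ ≤ X.advantage c z u τ := by
  conv_lhs => rw [h.eq_min]
  exact min_le_left _ _

lemma fetch_le (h : X.IsReducedSolution c z u) : z ≤ X.cf := by
  have := h.nonpos 0
  have := h.fetch_eq
  linarith

lemma bddAbove_neg (h : X.IsReducedSolution c z u) : BddAbove (Set.range fun τ => -u τ) := by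
  obtain ⟨B, hB⟩ := h.bounded
  exact ⟨B, by rintro _ ⟨τ, rfl⟩; exact (neg_le_abs _).trans (hB τ)⟩

lemma bddAbove_sub {c' z' : ℝ} {u' : ℝ≥0 → ℝ} (h : X.IsReducedSolution c z u)
    (h' : X.IsReducedSolution c' z' u') : BddAbove (Set.range fun τ => u τ - u' τ) := by
  obtain ⟨B, hB⟩ := h'.bounded
  refine ⟨B, ?_⟩
  rintro _ ⟨τ, rfl⟩
  have := h.nonpos τ
  have := (abs_le.1 (hB τ)).1
  dsimp only
  linarith

/-- The advantage is bounded below in terms of a bound on the value. -/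
lemma sub_le_advantage (h : X.IsReducedSolution c z u) {e : ℝ} (he : ∀ τ, -u τ ≤ e)
    (hez : 0 ≤ e + z) (τ : ℝ≥0) : c - X.p * z - e ≤ X.advantage c z u τ := by
  obtain ⟨B, hB⟩ := h.bounded
  have h1 := X.p_le_one
  have h0 := X.p_pos
  have h2 : ∀ s, - (X.p * z + e) ≤ X.gain z u s := fun s => by
    have h3 := he s
    have h4 := mul_nonneg X.ageing_nonneg s.coe_nonneg
    have h5 : -(e + z) ≤ min (X.ageing * s + u s - z) 0 := le_min (by linarith) (by linarith)
    unfold gain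
    nlinarith
  have := integral_mono (integrable_const _) (integrable_gain h.measurable hB τ) fun x => h2 (τ + x)
  simp only [integral_const, probReal_univ, smul_eq_mul, one_mul] at this
  unfold advantage
  linarith

/-- If z < 0, a bound -u ≤ e improves to max(0, e + p z). Hence u vanishes and z = c_f > 0, a
contradiction. -/
lemma fetch_nonneg (h : X.IsReducedSolution c z u) (hc : 0 ≤ c) : 0 ≤ z := by
  by_contra! hz
  have hcf := X.cf_pos
  have hpz : X.p * z < 0 := mul_neg_of_pos_of_neg X.p_pos hz
  have h0 : z = X.cf + u 0 := h.fetch_eq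
  have := nonpos_of_improvable h.bddAbove_neg
    (fun e he hD => ⟨max 0 (e + X.p * z), by simp [he, hpz], fun τ => ?_⟩) 0
  · linarith
  · have h2 := h.sub_le_advantage hD (by linarith [hD 0]) τ
    rw [h.eq_min τ, neg_le, le_min_iff]
    constructor
    · linarith [le_max_right 0 (e + X.p * z)]
    · linarith [le_max_left 0 (e + X.p * z)]

/-- If holding is more expensive than the saving on fetches, it never pays to keep the content. -/
lemma eq_zero_of_lt (h : X.IsReducedSolution c z u) (hc : 0 ≤ c) (hz : X.p * z < c) (τ : ℝ≥0) :
    u τ = 0 := by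
  refine le_antisymm (h.nonpos τ) (neg_nonpos.1 ?_)
  refine nonpos_of_improvable h.bddAbove_neg
    (fun e he hD => ⟨max 0 (e - (c - X.p * z)), by simp [he, hz], fun τ => ?_⟩) τ
  have h2 := h.sub_le_advantage hD (by linarith [h.fetch_nonneg hc]) τ
  rw [h.eq_min τ, neg_le, le_min_iff]
  constructor
  · linarith [le_max_right 0 (e - (c - X.p * z))]
  · linarith [le_max_left 0 (e - (c - X.p * z))]

lemma le_advantage_of_lt (h : X.IsReducedSolution c z u) (hc : 0 ≤ c) (hz : X.p * z < c)
    (τ : ℝ≥0) : c - X.p * z ≤ X.advantage c z u τ := by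
  simpa using h.sub_le_advantage (e := 0) (by simp [h.eq_zero_of_lt hc hz])
    (by linarith [h.fetch_nonneg hc]) τ

/-- The optimal average cost grows at most as fast as the holding cost. -/
lemma fetch_sub_le {c' z' : ℝ} {u' : ℝ≥0 → ℝ} (h : X.IsReducedSolution c z u)
    (h' : X.IsReducedSolution c' z' u') (hcc : c ≤ c') : X.p * (z' - z) ≤ c' - c := by
  by_contra! hlt
  obtain ⟨B, hB⟩ := h.bounded
  obtain ⟨B', hB'⟩ := h'.bounded
  have h0 := X.p_pos
  have h1 := X.p_le_one
  have hw : z' - z = u' 0 - u 0 := by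
    have := h.fetch_eq
    have := h'.fetch_eq
    linarith
  -- A bound u' - u ≤ e also dominates z' - z = u'(0) - u(0). The gains then differ by at most e -
  -- p(z' - z), and the advantages by at most e - (p(z' - z) - (c' - c)), which is less than e. So
  -- u' ≤ u, which gives z' ≤ z, against p(z' - z) > c' - c ≥ 0.
  have := nonpos_of_improvable (h'.bddAbove_sub h)
    (fun e he hD => ⟨max 0 (e - (X.p * (z' - z) - (c' - c))), max_lt he (by linarith), fun τ => ?_⟩) 0
  · nlinarith
  · have hw' : z' - z ≤ e := hw ▸ hD 0
    have h2 : ∀ s, X.gain z' u' s ≤ X.gain z u s + (e - X.p * (z' - z)) := fun s => by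
      have h3 := hD s
      have h4 : min (X.ageing * s + u' s - z') 0 ≤
          min (X.ageing * s + u s - z) 0 + (e - (z' - z)) := by
        rw [← min_add_add_right]
        exact min_le_min (by linarith) (by linarith)
      unfold gain
      nlinarith
    have h5 := advantage_le_of_gain_le (c := c') (c' := c) h'.measurable h.measurable hB' hB h2 τ
    rw [h'.eq_min τ, h.eq_min τ, sub_le_iff_le_add]
    rcases le_total (X.advantage c z u τ) 0 with h6 | h6
    · rw [min_eq_left h6]
      refine (min_le_left _ _).trans ?_
      linarith [le_max_right 0 (e - (X.p * (z' - z) - (c' - c)))]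
    · rw [min_eq_right h6]
      refine (min_le_right _ _).trans ?_
      linarith [le_max_left 0 (e - (X.p * (z' - z) - (c' - c)))]

/-- Let u - u' ≤ e and w = max(z' - z, 0). The gains differ by at most e + p w in general, and by at
most (1 - p) e at ages where both minima in the gains are 0. With q the probability of a gap
reaching such ages and p w ≤ c' - c, the advantages differ by at most (1 - p q) e - (c' - c) q.
Iterating brings e down to 0, and the last term then gives strictness. -/
lemma advantage_lt_of_ageing_pos {c' z' : ℝ} {u' : ℝ≥0 → ℝ} (h : X.IsReducedSolution c z u)
    (h' : X.IsReducedSolution c' z' u') (hκ : 0 < X.ageing) (hcc : c < c') (τ : ℝ≥0) :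
    X.advantage c z u τ < X.advantage c' z' u' τ := by
  obtain ⟨B, hB⟩ := h.bounded
  obtain ⟨B', hB'⟩ := h'.bounded
  have h0 := X.p_pos
  have h1 := X.p_le_one
  have hcf := X.cf_pos
  have hB0 : 0 ≤ B := (abs_nonneg _).trans (hB 0)
  have hB0' : 0 ≤ B' := (abs_nonneg _).trans (hB' 0)
  have hz := h.fetch_sub_le h' hcc.le
  set w := max (z' - z) 0 with hw
  have hw0 : 0 ≤ w := le_max_right _ _
  have hw1 : z' - z ≤ w := le_max_left _ _
  have hpw : X.p * w ≤ c' - c := by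
    rcases max_cases (z' - z) 0 with h2 | h2
    · rw [hw, h2.1]; exact hz
    · rw [hw, h2.1]; linarith
  -- Beyond this age the ageing cost exceeds any possible value of a copy plus the cost of a fetch,
  -- since z and z' are at most c_f. A request is then served by a fetch under both solutions.
  set S : ℝ≥0 := ((B + B' + X.cf) / X.ageing).toNNReal
  set q := X.gap.real (Set.Ici S)
  have hq : 0 < q := X.gap_Ici_pos S
  have hq1 : q ≤ 1 := measureReal_le_one
  have hS : ∀ s : ℝ≥0, S ≤ s → B + B' + X.cf ≤ X.ageing * s := fun s hs => by
    rw [Real.toNNReal_le_iff_le_coe, div_le_iff₀ hκ] at hs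
    linarith
  have key : ∀ e, 0 ≤ e → (∀ τ, u τ - u' τ ≤ e) → ∀ τ, X.advantage c z u τ ≤
      X.advantage c' z' u' τ + ((1 - X.p * q) * e - (c' - c) * q) := by
    intro e he hD τ
    have h2 : ∀ s, X.gain z u s ≤ X.gain z' u' s + (e + X.p * w) := fun s => by
      have h3 := hD s
      have h4 : min (X.ageing * s + u s - z) 0 ≤
          min (X.ageing * s + u' s - z') 0 + (e + w) := by
        rw [← min_add_add_right]
        exact min_le_min (by linarith) (by linarith)
      unfold gain
      nlinarith
    have h5 : ∀ s, S ≤ s →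
        X.gain z u s ≤ X.gain z' u' s + (e + X.p * w) - X.p * (e + w) := fun s hs => by
      have h3 := hD s
      have h6 := hS s hs
      have h7 := h.fetch_le
      have h8 := h'.fetch_le
      have h9 := (abs_le.1 (hB s)).1
      have h10 := (abs_le.1 (hB' s)).1
      unfold gain
      rw [min_eq_right (by linarith), min_eq_right (by linarith)]
      nlinarith
    have h11 := advantage_le (c := c) (c' := c') h.measurable h'.measurable hB hB' S
      h2 h5 τ
    have h12 : (X.p * w) * (1 - q) ≤ (c' - c) * (1 - q) :=
      mul_le_mul_of_nonneg_right hpw (by linarith)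
    change _ ≤ _ - _ * q at h11
    linarith
  have hD : ∀ τ, u τ - u' τ ≤ 0 := by
    refine nonpos_of_improvable (h.bddAbove_sub h') fun e he hD =>
      ⟨max 0 ((1 - X.p * q) * e), max_lt he ?_, fun τ => ?_⟩
    · have := mul_pos (mul_pos h0 hq) he
      linarith
    · have h2 := key e he.le hD τ
      have h3 : 0 ≤ (c' - c) * q := mul_nonneg (by linarith) hq.le
      rw [h'.eq_min τ, h.eq_min τ, sub_le_iff_le_add]
      rcases le_total (X.advantage c' z' u' τ) 0 with h6 | h6
      · rw [min_eq_left h6]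
        refine (min_le_left _ _).trans ?_
        linarith [le_max_right 0 ((1 - X.p * q) * e)]
      · rw [min_eq_right h6]
        refine (min_le_right _ _).trans ?_
        linarith [le_max_left 0 ((1 - X.p * q) * e)]
  have h2 := key 0 le_rfl hD τ
  have h3 : 0 < (c' - c) * q := mul_pos (by linarith) hq
  linarith

/-- If copies do not age, the advantage of keeping is the same for all of them. -/
lemma advantage_of_ageing_eq_zero (h : X.IsReducedSolution c z u) (hc : 0 ≤ c)
    (hκ : X.ageing = 0) (τ : ℝ≥0) :
    X.advantage c z u τ = if c ≤ X.p * X.cf then c / X.p - X.cf else c - X.p * X.cf := by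
  obtain ⟨B, hB⟩ := h.bounded
  have h0 := X.p_pos
  have h1 := X.p_le_one
  have hz := h.fetch_nonneg hc
  have hi : ∀ τ, Integrable (fun x => u (τ + x)) X.gap := fun τ =>
    X.integrable_gap (h.measurable.comp (by fun_prop)) (fun x => hB (τ + x))
  have hadv : ∀ τ, X.advantage c z u τ = c - X.p * z + ∫ x, u (τ + x) ∂X.gap := fun τ => by
    have h2 : ∀ s, X.gain z u s = u s - X.p * z := fun s => by
      unfold gain
      rw [min_eq_left, hκ]
      · ring
      · have := h.nonpos s
        rw [hκ]
        linarith
    unfold advantage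
    simp_rw [h2]
    rw [integral_sub (hi τ) (integrable_const _)]
    simp only [integral_const, probReal_univ, smul_eq_mul, one_mul]
    ring
  have hfe := h.fetch_eq
  have hfl := h.fetch_le
  rcases lt_trichotomy (X.p * z) c with hlt | heq | hgt
  · have hu := h.eq_zero_of_lt hc hlt
    have hz' : z = X.cf := by rw [hfe, hu, add_zero]
    rw [hadv, if_neg (by rw [← hz']; exact not_le.2 hlt), hz']
    simp [hu]
  -- When p z = c the drift vanishes, and u ≤ 0 makes the minimum with 0 redundant: u is harmonic,
  -- hence constant.
  · have hu : ∀ τ, u τ = ∫ x, u (τ + x) ∂X.gap := fun τ => by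
      rw [h.eq_min τ, hadv, heq, sub_self, zero_add, min_eq_left]
      exact integral_nonpos fun x => h.nonpos _
    have hconst := X.harmonic_const h.measurable hB hu
    have hcp : c ≤ X.p * X.cf := heq ▸ mul_le_mul_of_nonneg_left hfl h0.le
    rw [hadv, ← hu, hconst, heq, sub_self, zero_add, if_pos hcp, ← heq, mul_div_cancel_left₀ _ h0.ne']
    linarith
  · exfalso
    -- If p z > c, every upper bound of u drops by p z - c. The shift by B + 1 turns the resulting
    -- nonpositivity into u ≤ -B - 1, which contradicts |u| ≤ B.
    have hbd : BddAbove (Set.range fun τ => u τ + (B + 1)) := by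
      refine ⟨B + 1, ?_⟩
      rintro _ ⟨τ, rfl⟩
      have := h.nonpos τ
      dsimp only
      linarith
    have := nonpos_of_improvable hbd
      (fun e he hD => ⟨e - (X.p * z - c), by linarith, fun τ => ?_⟩) 0
    · linarith [(abs_le.1 (hB 0)).1]
    · have h2 := h.le_advantage τ
      rw [hadv] at h2
      have h3 := integral_mono (hi τ) (integrable_const (e - (B + 1)))
        fun x => by linarith [hD (τ + x)]
      simp only [integral_const, probReal_univ, smul_eq_mul, one_mul] at h3
      linarith

/-- The relative cost of keeping a copy instead of discarding it strictly increases with the holding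
cost. -/
lemma advantage_lt {c' z' : ℝ} {u' : ℝ≥0 → ℝ} (h : X.IsReducedSolution c z u)
    (h' : X.IsReducedSolution c' z' u') (hc : 0 ≤ c) (hcc : c < c') (τ : ℝ≥0) :
    X.advantage c z u τ < X.advantage c' z' u' τ := by
  rcases X.ageing_nonneg.lt_or_eq with hκ | hκ
  · exact h.advantage_lt_of_ageing_pos h' hκ hcc τ
  · rw [h.advantage_of_ageing_eq_zero hc hκ.symm,
      h'.advantage_of_ageing_eq_zero (hc.trans hcc.le) hκ.symm]
    have h0 := X.p_pos
    have h1 : c / X.p < c' / X.p := div_lt_div_of_pos_right hcc h0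
    split_ifs with h2 h3 h3
    · linarith
    · have h4 : c / X.p ≤ X.cf := by rw [div_le_iff₀ h0]; linarith
      linarith
    · linarith
    · linarith

end IsReducedSolution
end Content

/-! ### Existence of reduced solutions. -/

namespace Content

variable (X : Content)

/-- Value iteration for the reduced Bellman equation with the fetch cost `z` held fixed. -/
def valueIter (c z : ℝ) : ℕ → ℝ≥0 → ℝ
  | 0 => 0
  | n + 1 => fun τ => min (X.advantage c z (valueIter c z n) τ) 0

variable {X}

lemma measurable_valueIter (c z : ℝ) (n : ℕ) : Measurable (X.valueIter c z n) := by
  induction n with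
  | zero => exact measurable_zero
  | succ n ih => exact (measurable_advantage ih).min measurable_const

lemma valueIter_nonpos (c z : ℝ) (n : ℕ) (τ : ℝ≥0) : X.valueIter c z n τ ≤ 0 := by
  cases n with
  | zero => exact le_rfl
  | succ n => exact min_le_right _ _

lemma gain_eq_zero {z : ℝ} {u : ℝ≥0 → ℝ} {s : ℝ≥0} (hu : u s = 0) (hs : z ≤ X.ageing * s) :
    X.gain z u s = 0 := by
  unfold gain
  rw [hu, min_eq_right (by linarith)]
  simp

/-- A copy whose ageing cost already reaches z saves nothing: it only gets older, and holding it
costs c ≥ 0. -/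
lemma valueIter_eq_zero {c z : ℝ} (hc : 0 ≤ c) (n : ℕ) {τ : ℝ≥0} (hτ : z ≤ X.ageing * τ) :
    X.valueIter c z n τ = 0 := by
  induction n generalizing τ with
  | zero => rfl
  | succ n ih =>
    have h : ∀ x, X.gain z (X.valueIter c z n) (τ + x) = 0 := fun x => by
      have h2 : z ≤ X.ageing * ((τ + x : ℝ≥0) : ℝ) := by
        have := mul_nonneg X.ageing_nonneg x.coe_nonneg
        push_cast
        linarith [mul_add X.ageing (τ : ℝ) x]
      exact gain_eq_zero (ih h2) h2
    simp [valueIter, advantage, h, hc]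

lemma gain_mono {z : ℝ} {u u' : ℝ≥0 → ℝ} {s : ℝ≥0} (h : u s ≤ u' s) :
    X.gain z u s ≤ X.gain z u' s := by
  have h0 := X.p_pos
  have h1 := X.p_le_one
  have : min (X.ageing * s + u s - z) 0 ≤ min (X.ageing * s + u' s - z) 0 :=
    min_le_min (by linarith) le_rfl
  unfold gain
  nlinarith

section Ageing

variable {c z z' : ℝ} {S : ℝ≥0}

lemma exists_bound_valueIter (hc : 0 ≤ c) (n : ℕ) : ∃ B, ∀ τ, |X.valueIter c z n τ| ≤ B := by
  induction n with
  | zero => exact ⟨0, by simp [valueIter]⟩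
  | succ n ih =>
    obtain ⟨B, hB⟩ := ih
    refine ⟨B + |z|, fun τ => ?_⟩
    have h1 : |∫ x, X.gain z (X.valueIter c z n) (τ + x) ∂X.gap| ≤
        (B + |z|) * X.gap.real Set.univ := by
      rw [← Real.norm_eq_abs]
      exact norm_integral_le_of_norm_le_const (.of_forall fun x => abs_gain_le hB (τ + x))
    rw [probReal_univ, mul_one] at h1
    have h2 := (abs_le.1 h1).1
    have h3 : 0 ≤ B + |z| := (abs_nonneg _).trans h1
    rw [abs_of_nonpos (valueIter_nonpos _ _ _ _), neg_le]
    refine le_min ?_ (by linarith)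
    unfold advantage
    linarith

/-- Let d = |z - z'|. Beyond age S both gains vanish, so an error e + p d in the gains survives only
with weight 1 - q, where q = P(Δ ≥ S). The constant e = (p/q) d is stable under this step, so the
Lipschitz bound in z is uniform in n. -/
lemma valueIter_le_add (hc : 0 ≤ c) (hz : z ≤ X.ageing * S) (hz' : z' ≤ X.ageing * S) (n : ℕ) (τ : ℝ≥0) :
    X.valueIter c z n τ ≤
      X.valueIter c z' n τ + X.p / X.gap.real (Set.Ici S) * |z - z'| := by
  have hq : 0 < X.gap.real (Set.Ici S) := X.gap_Ici_pos S
  have h0 := X.p_pos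
  have h1 := X.p_le_one
  have hd := abs_nonneg (z - z')
  have hd' := neg_abs_le (z - z')
  have he : 0 ≤ X.p / X.gap.real (Set.Ici S) * |z - z'| := by positivity
  induction n generalizing τ with
  | zero => simpa [valueIter] using he
  | succ n ih =>
    obtain ⟨B, hB⟩ := exists_bound_valueIter (X := X) (z := z) hc n
    obtain ⟨B', hB'⟩ := exists_bound_valueIter (X := X) (z := z') hc n
    have hmono : ∀ s, S ≤ s → X.ageing * S ≤ X.ageing * s := fun s hs =>
      mul_le_mul_of_nonneg_left (by exact_mod_cast hs) X.ageing_nonneg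
    have key := advantage_le (c := c) (c' := c) (X := X) (z := z) (z' := z')
      -- Here k = l: the whole gain error is recovered beyond age `S`.
      (k := X.p / X.gap.real (Set.Ici S) * |z - z'| + X.p * |z - z'|)
      (l := X.p / X.gap.real (Set.Ici S) * |z - z'| + X.p * |z - z'|)
      (measurable_valueIter c z n) (measurable_valueIter c z' n) hB hB' S (fun s => ?_)
      (fun s hs => ?_) τ
    · have h2 : X.p / X.gap.real (Set.Ici S) * |z - z'| * X.gap.real (Set.Ici S) =
          X.p * |z - z'| := by field_simp
      have h3 : 0 ≤ X.p * |z - z'| * X.gap.real (Set.Ici S) := by positivity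
      simp only [valueIter]
      rw [← min_add_add_right]
      refine le_min ((min_le_left _ _).trans ?_) ((min_le_right _ _).trans (by linarith))
      linarith
    · have h3 := ih s
      set e := X.p / X.gap.real (Set.Ici S) * |z - z'|
      have h4 : min (X.ageing * s + X.valueIter c z n s - z) 0 ≤
          min (X.ageing * s + X.valueIter c z' n s - z') 0 + (e + |z - z'|) := by
        rw [← min_add_add_right]
        exact min_le_min (by linarith) (by linarith)
      unfold gain
      nlinarith
    · have h3 := hz.trans (hmono s hs)
      have h4 := hz'.trans (hmono s hs)
      rw [gain_eq_zero (valueIter_eq_zero hc n h3) h3, gain_eq_zero (valueIter_eq_zero hc n h4) h4]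
      linarith

/-- Comparison with fetch cost 0, for which every iterate vanishes. -/
lemma neg_le_valueIter (hc : 0 ≤ c) (hz0 : 0 ≤ z) (hz : z ≤ X.ageing * S) (n : ℕ) (τ : ℝ≥0) :
    -(X.p / X.gap.real (Set.Ici S) * z) ≤ X.valueIter c z n τ := by
  have h := valueIter_le_add (X := X) (z := 0) hc
    (mul_nonneg X.ageing_nonneg S.coe_nonneg) hz n τ
  rw [valueIter_eq_zero hc n (mul_nonneg X.ageing_nonneg τ.coe_nonneg), zero_sub, abs_neg,
    abs_of_nonneg hz0] at h
  linarith

lemma antitone_valueIter (hc : 0 ≤ c) (τ : ℝ≥0) : Antitone fun n => X.valueIter c z n τ := by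
  refine antitone_nat_of_succ_le fun n => ?_
  induction n generalizing τ with
  | zero => exact min_le_right _ _
  | succ n ih =>
    obtain ⟨B, hB⟩ := exists_bound_valueIter (X := X) (z := z) hc n
    obtain ⟨B', hB'⟩ := exists_bound_valueIter (X := X) (z := z) hc (n + 1)
    refine min_le_min ?_ le_rfl
    have := advantage_le_of_gain_le (c := c) (c' := c) (X := X) (z := z) (z' := z) (k := 0)
      (measurable_valueIter c z (n + 1)) (measurable_valueIter c z n) hB' hB
      (fun s => by simpa using gain_mono (ih s)) τ
    linarith

variable (X c z) in
/-- The limit of value iteration. -/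
def valueLim (τ : ℝ≥0) : ℝ := ⨅ n, X.valueIter c z n τ

lemma tendsto_valueIter (hc : 0 ≤ c) (hz0 : 0 ≤ z) (hz : z ≤ X.ageing * S) (τ : ℝ≥0) :
    Tendsto (fun n => X.valueIter c z n τ) atTop (nhds (X.valueLim c z τ)) :=
  tendsto_atTop_ciInf (antitone_valueIter hc τ)
    ⟨_, by rintro _ ⟨n, rfl⟩; exact neg_le_valueIter hc hz0 hz n τ⟩

/-- The bound uniform in n allows dominated convergence in the advantage. -/
lemma valueLim_eq (hc : 0 ≤ c) (hz0 : 0 ≤ z) (hz : z ≤ X.ageing * S) (τ : ℝ≥0) :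
    X.valueLim c z τ = min (X.advantage c z (X.valueLim c z) τ) 0 := by
  have hB : ∀ n τ, |X.valueIter c z n τ| ≤ X.p / X.gap.real (Set.Ici S) * z := fun n τ => by
    rw [abs_of_nonpos (valueIter_nonpos _ _ _ _)]
    linarith [neg_le_valueIter hc hz0 hz n τ]
  have h1 : Tendsto (fun n => X.advantage c z (X.valueIter c z n) τ) atTop
      (nhds (X.advantage c z (X.valueLim c z) τ)) := by
    refine tendsto_const_nhds.add ?_
    refine tendsto_integral_of_dominated_convergence
      (fun _ => X.p / X.gap.real (Set.Ici S) * z + |z|)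
      (fun n => (integrable_gain (measurable_valueIter c z n) (hB n) τ).aestronglyMeasurable)
      (integrable_const _) (fun n => .of_forall fun x => abs_gain_le (hB n) (τ + x))
      (.of_forall fun x => ?_)
    have h2 := tendsto_valueIter hc hz0 hz (τ + x)
    unfold gain
    exact ((((h2.const_add _).sub_const _).min tendsto_const_nhds).const_mul _).add
      (h2.const_mul _)
  exact tendsto_nhds_unique ((tendsto_add_atTop_iff_nat 1).2 (tendsto_valueIter hc hz0 hz τ))
    (h1.min tendsto_const_nhds)

/-- Shooting in z: each z in [0, c_f] gives a solution u_z of the minimum equation, and it remains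
to solve z = c_f + u_z(0). The function c_f + u_z(0) - z is Lipschitz in z, equals c_f > 0 at 0, and
is nonpositive at c_f. -/
lemma exists_isReducedSolution_of_ageing_pos (hc : 0 ≤ c) (hκ : 0 < X.ageing) :
    ∃ z u, X.IsReducedSolution c z u := by
  have hcf := X.cf_pos
  obtain ⟨S, hS⟩ : ∃ S : ℝ≥0, X.ageing * S = X.cf :=
    ⟨⟨X.cf / X.ageing, by positivity⟩, by
      change X.ageing * (X.cf / X.ageing) = X.cf
      field_simp⟩
  have hlip : ∀ z ∈ Set.Icc 0 X.cf, ∀ z' ∈ Set.Icc 0 X.cf, X.valueLim c z 0 ≤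
      X.valueLim c z' 0 + X.p / X.gap.real (Set.Ici S) * |z - z'| := fun z hz z' hz' =>
    le_of_tendsto_of_tendsto' (tendsto_valueIter hc hz.1 (hS ▸ hz.2) 0)
      ((tendsto_valueIter hc hz'.1 (hS ▸ hz'.2) 0).add_const _)
      fun n => valueIter_le_add hc (hS ▸ hz.2) (hS ▸ hz'.2) n 0
  have hcont : ContinuousOn (fun z => X.cf + X.valueLim c z 0 - z) (Set.Icc 0 X.cf) := by
    refine (ContinuousOn.const_add ?_ _).sub continuousOn_id
    refine (LipschitzOnWith.of_dist_le_mul (K := (X.p / X.gap.real (Set.Ici S)).toNNReal)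
      fun z hz z' hz' => ?_).continuousOn
    rw [Real.coe_toNNReal _ (div_nonneg X.p_pos.le measureReal_nonneg), Real.dist_eq, Real.dist_eq,
      abs_sub_le_iff]
    have h1 := hlip z hz z' hz'
    have h2 := hlip z' hz' z hz
    rw [abs_sub_comm z'] at h2
    constructor <;> linarith
  have hnp : ∀ z, z ∈ Set.Icc 0 X.cf → ∀ τ, X.valueLim c z τ ≤ 0 := fun z hz τ => by
    rw [valueLim_eq hc hz.1 (hS ▸ hz.2)]
    exact min_le_right _ _
  have h0 : X.valueLim c 0 0 = 0 := by
    simp [valueLim, valueIter_eq_zero (X := X) (z := 0) (τ := 0) hc _ (by simp)]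
  obtain ⟨z, hz, hz2⟩ := intermediate_value_Icc' hcf.le hcont
    (show (0 : ℝ) ∈ _ by
      constructor
      · linarith [hnp X.cf ⟨hcf.le, le_rfl⟩ 0]
      · rw [h0]; linarith)
  refine ⟨z, X.valueLim c z, Measurable.iInf fun n => measurable_valueIter c z n, ?_,
    valueLim_eq hc hz.1 (hS ▸ hz.2), by dsimp only at hz2; linarith⟩
  refine ⟨X.p / X.gap.real (Set.Ici S) * z, fun τ => ?_⟩
  rw [abs_of_nonpos (hnp z hz τ), neg_le]
  exact ge_of_tendsto' (tendsto_valueIter hc hz.1 (hS ▸ hz.2) τ)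
    fun n => neg_le_valueIter hc hz.1 (hS ▸ hz.2) n τ

end Ageing

/-- Without ageing, constants solve the system. If c ≤ p c_f, keeping forever costs c per epoch, so
p z = c; otherwise copies are worthless and z = c_f. -/
lemma exists_isReducedSolution_of_ageing_eq_zero (c : ℝ) (hκ : X.ageing = 0) :
    ∃ z u, X.IsReducedSolution c z u := by
  have h0 := X.p_pos
  have hcf := X.cf_pos
  by_cases h : c ≤ X.p * X.cf
  · have h1 : c / X.p - X.cf ≤ 0 := by
      rw [sub_nonpos, div_le_iff₀ h0]
      linarith
    refine ⟨c / X.p, fun _ => c / X.p - X.cf, measurable_const, ⟨_, fun _ => le_rfl⟩,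
      fun τ => ?_, by ring⟩
    have h2 : ∀ s, X.gain (c / X.p) (fun _ => c / X.p - X.cf) s = c / X.p - X.cf - c := fun s => by
      unfold gain
      rw [hκ, min_eq_left (by linarith)]
      field_simp
      ring
    simp only [advantage, h2]
    simp [h1]
  · refine ⟨X.cf, fun _ => 0, measurable_const, ⟨0, by simp⟩, fun τ => ?_, by ring⟩
    have h2 : ∀ s, X.gain X.cf (fun _ => 0) s = -(X.p * X.cf) := fun s => by
      unfold gain
      rw [hκ, min_eq_left (by linarith)]
      ring
    simp only [advantage, h2]
    simp only [integral_const, probReal_univ, smul_eq_mul, one_mul]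
    rw [min_eq_right (by linarith)]

lemma exists_isReducedSolution {c : ℝ} (hc : 0 ≤ c) : ∃ z u, X.IsReducedSolution c z u := by
  rcases X.ageing_nonneg.lt_or_eq with hκ | hκ
  · exact exists_isReducedSolution_of_ageing_pos hc hκ
  · exact exists_isReducedSolution_of_ageing_eq_zero c hκ.symm

end Content

/-! ### Bellman's equation and the reduced equation are equivalent. -/

namespace Content

variable (X : Content)

/-- The relative value function, normalized to be `0` in the state `(0, 0)`. -/
def relValue (z : ℝ) (u : ℝ≥0 → ℝ) : State → ℝ
  | Sum.inl (τ, true) => min (X.ageing * τ + u τ) z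
  | Sum.inl (τ, false) => u τ
  | Sum.inr true => z
  | Sum.inr false => 0

/-- The right-hand side of Bellman's equation in terms of the reduced solution. -/
def relCost (c z : ℝ) (u : ℝ≥0 → ℝ) : State → Action → ℝ
  | Sum.inl (τ, true), .keep => X.ageing * τ + X.advantage c z u τ
  | Sum.inl (_, true), .fetchKeep => X.cf + X.advantage c z u 0
  | Sum.inl (τ, true), .discard => X.ageing * τ
  | Sum.inl (_, true), .fetchDiscard => X.cf
  | Sum.inl (τ, false), .keep => X.advantage c z u τ
  | Sum.inr true, .fetchKeep => X.cf + X.advantage c z u 0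
  | Sum.inr true, .fetchDiscard => X.cf
  | _, _ => 0

variable {X}

lemma measurable_relValue {z : ℝ} {u : ℝ≥0 → ℝ} (hu : Measurable u) :
    Measurable (X.relValue z u) := by
  refine measurable_fun_sum (measurable_from_prod_countable_left fun b => ?_) (Measurable.of_discrete)
  cases b
  · exact hu
  · exact ((by fun_prop : Measurable fun τ : ℝ≥0 => X.ageing * τ + u τ)).min measurable_const

lemma abs_relValue_le {z B : ℝ} {u : ℝ≥0 → ℝ} (hB : ∀ s, |u s| ≤ B) (s : State) :
    |X.relValue z u s| ≤ B + |z| := by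
  have hB0 : 0 ≤ B := (abs_nonneg _).trans (hB 0)
  have hz := abs_nonneg z
  match s with
  | Sum.inl (τ, true) =>
    have h1 := abs_le.1 (hB τ)
    have h2 := mul_nonneg X.ageing_nonneg τ.coe_nonneg
    rw [relValue, abs_le]
    exact ⟨le_min (by linarith) (by linarith [neg_abs_le z]),
      (min_le_right _ _).trans (by linarith [le_abs_self z])⟩
  | Sum.inl (τ, false) => exact (hB τ).trans (by linarith)
  | Sum.inr true => rw [relValue]; linarith
  | Sum.inr false => rw [relValue, abs_zero]; linarith

/-- Splitting min(a, z) = min(a - z, 0) + z separates the cost p z of arriving with an empty cache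
from the gain due to the copy. -/
lemma integral_inl {h : State → ℝ} {z B k : ℝ} {u : ℝ≥0 → ℝ} (hu : Measurable u)
    (hB : ∀ s, |u s| ≤ B) (hh : ∀ s, h s = k + X.relValue z u s) (τ : ℝ≥0) :
    ∫ x, h (Sum.inl (τ + x.1, x.2)) ∂X.noise =
      k + X.p * z + ∫ x, X.gain z u (τ + x) ∂X.gap := by
  have hm : Measurable fun x : ℝ≥0 × Bool => X.relValue z u (Sum.inl (τ + x.1, x.2)) :=
    (measurable_relValue hu).comp (by fun_prop)
  have hb : ∀ x : ℝ≥0 × Bool, |X.relValue z u (Sum.inl (τ + x.1, x.2))| ≤ B + |z| := fun x =>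
    abs_relValue_le hB _
  simp_rw [hh]
  rw [integral_add (integrable_const _) (X.integrable_noise hm hb), X.integral_noise hm hb]
  have h1 : ∀ x, X.p * X.relValue z u (Sum.inl (τ + x, true)) +
      (1 - X.p) * X.relValue z u (Sum.inl (τ + x, false)) =
      X.p * z + X.gain z u (τ + x) := fun x => by
    have h2 : min (X.ageing * ((τ + x : ℝ≥0) : ℝ) + u (τ + x)) z =
        min (X.ageing * ((τ + x : ℝ≥0) : ℝ) + u (τ + x) - z) 0 + z := by
      rw [← min_add_add_right]
      simp
    simp only [relValue, gain, h2]
    ring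
  simp only [h1]
  rw [integral_add (integrable_const _) (integrable_gain hu hB τ)]
  simp [add_assoc]

/-- The condition on θ makes -θ/β cancel the expected continuation p z of an empty cache, so passive
actions retain only their immediate cost and k. -/
lemma bellmanValue_eq {h : State → ℝ} {Ch θ z B k : ℝ} {u : ℝ≥0 → ℝ} (hu : Measurable u)
    (hB : ∀ s, |u s| ≤ B) (hh : ∀ s, h s = k + X.relValue z u s) (hθ : θ / X.β = X.p * z)
    {s : State} {a : Action} (ha : a ∈ admissible s) :
    X.bellmanValue Ch θ h s a = k + X.relCost (Ch / X.β) z u s a := by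
  have h1 := integral_inl (X := X) hu hB hh
  have h2 : ∫ x, h (Sum.inr x.2) ∂X.noise = k + X.p * z := by
    rw [X.integral_noise_snd fun b => h (Sum.inr b), hh, hh, relValue, relValue]
    ring
  have h3 : ∫ x, h (Sum.inl x) ∂X.noise = k + X.p * z + ∫ x, X.gain z u (0 + x) ∂X.gap := by
    simpa using h1 0
  match s, a with
  | Sum.inl (τ, true), .keep =>
    simp only [bellmanValue, next, cost, relCost, advantage, h1, hθ, ageing]; ring
  | Sum.inl (τ, true), .fetchKeep =>
    simp only [bellmanValue, next, cost, relCost, advantage, h3, hθ]; ring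
  | Sum.inl (τ, true), .discard =>
    simp only [bellmanValue, next, cost, relCost, h2, hθ, ageing]; ring
  | Sum.inl (τ, true), .fetchDiscard =>
    simp only [bellmanValue, next, cost, relCost, h2, hθ]; ring
  | Sum.inl (τ, true), .idle => simp [admissible] at ha
  | Sum.inl (τ, false), .keep =>
    simp only [bellmanValue, next, cost, relCost, advantage, h1, hθ]; ring
  | Sum.inl (τ, false), .fetchKeep => simp [admissible] at ha
  | Sum.inl (τ, false), .discard =>
    simp only [bellmanValue, next, cost, relCost, h2, hθ]; ring
  | Sum.inl (τ, false), .fetchDiscard => simp [admissible] at ha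
  | Sum.inl (τ, false), .idle => simp [admissible] at ha
  | Sum.inr true, .keep => simp [admissible] at ha
  | Sum.inr true, .fetchKeep =>
    simp only [bellmanValue, next, cost, relCost, advantage, h3, hθ]; ring
  | Sum.inr true, .discard => simp [admissible] at ha
  | Sum.inr true, .fetchDiscard =>
    simp only [bellmanValue, next, cost, relCost, h2, hθ]; ring
  | Sum.inr true, .idle => simp [admissible] at ha
  | Sum.inr false, .keep => simp [admissible] at ha
  | Sum.inr false, .fetchKeep => simp [admissible] at ha
  | Sum.inr false, .discard => simp [admissible] at ha
  | Sum.inr false, .fetchDiscard => simp [admissible] at ha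
  | Sum.inr false, .idle =>
    simp only [bellmanValue, next, cost, relCost, h2, hθ]; ring

lemma isLeast_image_four (f : Action → ℝ) (a b c d : Action) :
    IsLeast (f '' {a, b, c, d}) (min (f a) (min (f b) (min (f c) (f d)))) := by
  rw [Set.image_insert_eq, Set.image_insert_eq, Set.image_pair]
  exact (isLeast_pair.insert _).insert _

lemma isLeast_image_pair (f : Action → ℝ) (a b : Action) :
    IsLeast (f '' {a, b}) (min (f a) (f b)) := by
  rw [Set.image_pair]
  exact isLeast_pair

lemma isLeast_relCost {c z : ℝ} {u : ℝ≥0 → ℝ} (h : X.IsReducedSolution c z u) (s : State) :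
    IsLeast (X.relCost c z u s '' admissible s) (X.relValue z u s) := by
  have hz : z = min (X.cf + X.advantage c z u 0) X.cf := by
    have h0 := h.eq_min 0
    have := h.fetch_eq
    rw [h0, ← min_add_add_left, add_zero] at this
    exact this
  match s with
  | Sum.inl (τ, true) =>
    convert! isLeast_image_four (X.relCost c z u (Sum.inl (τ, true))) .keep .fetchKeep .discard
      .fetchDiscard using 1
    simp only [relValue, relCost]
    conv_lhs => rw [hz, h.eq_min τ, ← min_add_add_left, add_zero]
    rw [min_assoc, min_left_comm (X.ageing * (τ : ℝ))]
  | Sum.inl (τ, false) =>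
    convert! isLeast_image_pair (X.relCost c z u (Sum.inl (τ, false))) .keep .discard using 1
    exact h.eq_min τ
  | Sum.inr true =>
    convert! isLeast_image_pair (X.relCost c z u (Sum.inr true)) .fetchKeep .fetchDiscard using 1
  | Sum.inr false =>
    simp [admissible, relCost, relValue]

lemma isBellmanSolution_relValue {Ch z : ℝ} {u : ℝ≥0 → ℝ}
    (h : X.IsReducedSolution (Ch / X.β) z u) :
    X.IsBellmanSolution Ch (X.β * (X.p * z)) (X.relValue z u) := by
  obtain ⟨B, hB⟩ := h.bounded
  refine ⟨measurable_relValue h.measurable, ⟨_, abs_relValue_le hB⟩, fun s => ?_⟩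
  convert! isLeast_relCost h s using 1
  refine Set.image_congr fun a ha => ?_
  rw [bellmanValue_eq (k := 0) h.measurable hB (by simp)
    (mul_div_cancel_left₀ _ X.β_pos.ne') ha, zero_add]

/-- Every solution of Bellman's equation arises from the reduced equation. -/
lemma IsBellmanSolution.exists_reduced {Ch θ : ℝ} {h : State → ℝ}
    (hb : X.IsBellmanSolution Ch θ h) : ∃ k z u, X.IsReducedSolution (Ch / X.β) z u ∧
      θ / X.β = X.p * z ∧ ∀ s, h s = k + X.relValue z u s := by
  obtain ⟨hm, ⟨B, hB⟩, hl⟩ := hb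
  set k := h (Sum.inr false) with hk
  set z := h (Sum.inr true) - k with hz
  set u : ℝ≥0 → ℝ := fun τ => h (Sum.inl (τ, false)) - k with hu
  have hum : Measurable u := (hm.comp (by fun_prop)).sub_const _
  have huB : ∀ τ, |u τ| ≤ B + |k| := fun τ => (abs_sub _ _).trans (by linarith [hB (Sum.inl (τ, false))])
  have hH : ∫ x, h (Sum.inr x.2) ∂X.noise = k + X.p * z := by
    rw [X.integral_noise_snd fun b => h (Sum.inr b), hz, hk]
    ring
  have h1 := fun τ => (hl (Sum.inl (τ, true))).unique (isLeast_image_four _ _ _ _ _)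
  have h2 := fun τ => (hl (Sum.inl (τ, false))).unique (isLeast_image_pair _ _ _)
  have h3 := (hl (Sum.inr true)).unique (isLeast_image_pair _ _ _)
  have h4 : h (Sum.inr false) = X.bellmanValue Ch θ h (Sum.inr false) .idle :=
    (hl (Sum.inr false)).unique (by simp [admissible])
  -- The state (0,0), with its single cost-free transition, fixes θ.
  have hθ : θ / X.β = X.p * z := by
    simp only [bellmanValue, next, cost, hH] at h4
    rw [← hk] at h4
    linarith
  have hh : ∀ s, h s = k + X.relValue z u s := by
    intro s
    match s with
    | Sum.inl (τ, true) =>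
      have h5 := h1 τ
      have h6 := h2 τ
      -- In (τ,1,1) the four actions regroup into serving from the copy, which is the choice in
      -- (τ,1,0) plus the ageing cost, and fetching, which is the choice in (0,1).
      have h7 : ∀ t a b d e : ℝ,
          min (t + a) (min d (min (t + b) e)) = min (t + min a b) (min d e) := fun t a b d e => by
        rw [← min_add_add_left, min_assoc, min_left_comm d]
      simp only [bellmanValue, next, cost, zero_sub] at h5 h6 h3
      simp only [relValue, hu, hz]
      rw [← min_add_add_left, add_sub_cancel, add_left_comm, add_sub_cancel, h6, h3, ageing, ← h7, h5]
      congr 1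
      · ring
      · congr 2
        ring
    | Sum.inl (τ, false) => simp [relValue, hu]
    | Sum.inr true => simp [relValue, hz]
    | Sum.inr false => simp [relValue, hk]
  refine ⟨k, z, u, ⟨hum, ⟨_, huB⟩, fun τ => ?_, ?_⟩, hθ, hh⟩
  · have h5 := h2 τ
    rw [bellmanValue_eq hum huB hh hθ (by simp [admissible]),
      bellmanValue_eq hum huB hh hθ (by simp [admissible]), hh, min_add_add_left] at h5
    exact add_left_cancel h5
  · have h5 := h2 0
    rw [bellmanValue_eq hum huB hh hθ (by simp [admissible]),
      bellmanValue_eq hum huB hh hθ (by simp [admissible]), hh, min_add_add_left] at h5 h3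
    have h6 := add_left_cancel h5
    have h7 := add_left_cancel h3
    simp only [relValue, relCost] at h6 h7
    rw [h7, h6, ← min_add_add_left, add_zero]

end Content

/-! ### Greedy policies and their passive sets. -/

namespace Content

variable {X : Content}

lemma IsReducedSolution.fetch_eq_min {c z : ℝ} {u : ℝ≥0 → ℝ} (h : X.IsReducedSolution c z u) :
    z = X.cf + min (X.advantage c z u 0) 0 := by
  rw [← h.eq_min]
  exact h.fetch_eq

/-- A rule that attains the minimum in the reduced equation in every state. -/
def IsGreedy (X : Content) (c z : ℝ) (u : ℝ≥0 → ℝ) (μ : DecisionRule) : Prop :=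
  ∀ s, X.relCost c z u s (μ.act s) = X.relValue z u s

/-- The policy brings its own Bellman solution, and this is all the passive sets require. The later
comparisons hold between any two reduced solutions. -/
lemma IsOptimalPolicy.exists_greedy {Ch : ℝ} {μ : DecisionRule} (h : X.IsOptimalPolicy Ch μ) :
    ∃ z u, X.IsReducedSolution (Ch / X.β) z u ∧ X.IsGreedy (Ch / X.β) z u μ := by
  obtain ⟨-, θ, h, hb, hμ⟩ := h
  obtain ⟨k, z, u, hr, hθ, hh⟩ := hb.exists_reduced
  obtain ⟨B, hB⟩ := hr.bounded
  refine ⟨z, u, hr, fun s => ?_⟩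
  have h1 := hμ s
  rw [bellmanValue_eq hr.measurable hB hh hθ (μ.act_mem s), hh s] at h1
  exact add_left_cancel h1

lemma isOptimalAction_of_relCost_eq {Ch z : ℝ} {u : ℝ≥0 → ℝ} {s : State} {a : Action}
    (h : X.IsReducedSolution (Ch / X.β) z u) (ha : a ∈ admissible s)
    (hs : X.relCost (Ch / X.β) z u s a = X.relValue z u s) : X.IsOptimalAction Ch s a := by
  obtain ⟨B, hB⟩ := h.bounded
  refine ⟨ha, _, _, isBellmanSolution_relValue h, ?_⟩
  rw [bellmanValue_eq (k := 0) h.measurable hB (by simp)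
    (mul_div_cancel_left₀ _ X.β_pos.ne') ha, zero_add, hs]

lemma passiveSet_subset_actionStates (μ : DecisionRule) : passiveSet μ ⊆ actionStates := by
  rintro s hs rfl
  have h := μ.act_mem (Sum.inr false)
  simp only [admissible, Set.mem_singleton_iff] at h
  simp [passiveSet, passiveActions, h] at hs

lemma advantage_nonpos {z : ℝ} {u : ℝ≥0 → ℝ} (h : X.IsReducedSolution 0 z u) (τ : ℝ≥0) :
    X.advantage 0 z u τ ≤ 0 := by
  have h1 := X.p_le_one
  unfold advantage
  rw [zero_add]
  refine integral_nonpos fun x => add_nonpos ?_ ?_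
  · exact mul_nonpos_of_nonneg_of_nonpos X.p_pos.le (min_le_right _ _)
  · exact mul_nonpos_of_nonneg_of_nonpos (by linarith) (h.nonpos _)

/-- Without holding costs, keeping the content in the cache is optimal. -/
lemma exists_active_isOptimalAction {z : ℝ} {u : ℝ≥0 → ℝ} (h : X.IsReducedSolution (0 / X.β) z u)
    {s : State} (hs : s ∈ actionStates) : ∃ a ∈ activeActions, X.IsOptimalAction 0 s a := by
  have h' := h
  rw [zero_div] at h'
  have hf := advantage_nonpos h'
  have hu : ∀ τ, u τ = X.advantage 0 z u τ := fun τ => by rw [h'.eq_min, min_eq_left (hf τ)]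
  have hz := h'.fetch_eq
  rw [hu] at hz
  match s with
  | Sum.inl (τ, true) =>
    rcases le_total (X.ageing * τ + u τ) z with h2 | h2
    · refine ⟨.keep, by simp [activeActions],
        isOptimalAction_of_relCost_eq h (by simp [admissible]) ?_⟩
      rw [zero_div, relCost, relValue, min_eq_left h2, hu τ]
    · refine ⟨.fetchKeep, by simp [activeActions],
        isOptimalAction_of_relCost_eq h (by simp [admissible]) ?_⟩
      rw [zero_div, relCost, relValue, min_eq_right h2, ← hz]
  | Sum.inl (τ, false) =>
    refine ⟨.keep, by simp [activeActions],
      isOptimalAction_of_relCost_eq h (by simp [admissible]) ?_⟩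
    rw [zero_div, relCost, relValue, hu τ]
  | Sum.inr true =>
    refine ⟨.fetchKeep, by simp [activeActions],
      isOptimalAction_of_relCost_eq h (by simp [admissible]) ?_⟩
    rw [zero_div, relCost, relValue, ← hz]
  | Sum.inr false => exact absurd rfl hs

/-- Every state with a choice has an optimal active action, so the tie rule at zero holding cost
applies in all of them. -/
lemma passiveSet_zero_eq_empty {μ : ℝ → DecisionRule} (h : X.IsOptimalFamily μ) :
    passiveSet (μ 0) = ∅ := by
  refine Set.eq_empty_iff_forall_notMem.2 fun s hs => ?_
  obtain ⟨z, u, hr, -⟩ := (h.1 0 le_rfl).exists_greedy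
  have h1 := h.2 s (exists_active_isOptimalAction hr (passiveSet_subset_actionStates _ hs))
  have h2 : (μ 0).act s ∈ passiveActions := hs
  rcases h1 with h1 | h1 <;> rw [h1] at h2 <;> simp [passiveActions] at h2

/-- Since z ≤ c_f, also p z < c. All advantages are then positive, and each active action is
strictly worse than its passive counterpart. -/
lemma IsGreedy.passiveSet_eq {c z : ℝ} {u : ℝ≥0 → ℝ} {μ : DecisionRule}
    (h : X.IsReducedSolution c z u) (hμ : X.IsGreedy c z u μ) (hc : X.p * X.cf < c) :
    passiveSet μ = actionStates := by
  refine (passiveSet_subset_actionStates μ).antisymm fun s hs => ?_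
  have h0 : 0 ≤ c := (mul_pos X.p_pos X.cf_pos).le.trans hc.le
  have hzc : X.p * z < c := (mul_le_mul_of_nonneg_left h.fetch_le X.p_pos.le).trans_lt hc
  have hf : ∀ τ, 0 < X.advantage c z u τ := fun τ => by
    linarith [h.le_advantage_of_lt h0 hzc τ]
  have hu := h.eq_zero_of_lt h0 hzc
  have hz : z = X.cf := by rw [h.fetch_eq, hu, add_zero]
  have hm := μ.act_mem s
  have hg := hμ s
  change μ.act s ∈ passiveActions
  revert hm hg
  generalize μ.act s = a
  intro hm hg
  match s, a with
  | _, .discard => simp [passiveActions]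
  | _, .fetchDiscard => simp [passiveActions]
  | Sum.inl (τ, true), .keep =>
    rw [relCost, relValue, hu] at hg
    linarith [hf τ, min_le_left (X.ageing * (τ : ℝ) + 0) z]
  | Sum.inl (τ, true), .fetchKeep =>
    rw [relCost, relValue, hu] at hg
    linarith [hf 0, min_le_right (X.ageing * (τ : ℝ) + 0) z]
  | Sum.inl (τ, true), .idle => simp [admissible] at hm
  | Sum.inl (τ, false), .keep =>
    rw [relCost, relValue, hu] at hg
    linarith [hf τ]
  | Sum.inl (τ, false), .fetchKeep => simp [admissible] at hm
  | Sum.inl (τ, false), .idle => simp [admissible] at hm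
  | Sum.inr true, .fetchKeep =>
    rw [relCost, relValue] at hg
    linarith [hf 0]
  | Sum.inr true, .keep => simp [admissible] at hm
  | Sum.inr true, .idle => simp [admissible] at hm
  | Sum.inr false, _ => exact absurd rfl hs

/-- If discarding is optimal, it is the only optimal choice under a higher holding cost. -/
lemma IsGreedy.passiveSet_subset {c c' z z' : ℝ} {u u' : ℝ≥0 → ℝ} {μ μ' : DecisionRule}
    (h : X.IsReducedSolution c z u) (hμ : X.IsGreedy c z u μ) (h' : X.IsReducedSolution c' z' u')
    (hμ' : X.IsGreedy c' z' u' μ') (hc : 0 ≤ c) (hcc : c < c') :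
    passiveSet μ ⊆ passiveSet μ' := by
  intro s hs
  have hlt := h.advantage_lt h' hc hcc
  have hm := μ.act_mem s
  have hm' := μ'.act_mem s
  have hg := hμ s
  have hg' := hμ' s
  have hz := h.fetch_eq_min
  have hz' := h'.fetch_eq_min
  change μ'.act s ∈ passiveActions
  change μ.act s ∈ passiveActions at hs
  revert hm hm' hg hg' hs
  generalize μ.act s = a
  generalize μ'.act s = a'
  intro hm hm' hg hg' hs
  -- The costs of passive actions agree under both solutions, while the cost of each active action
  -- has strictly increased. This also settles the mixed cases in which one action fetches and the
  -- other does not.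
  match s, a, a' with
  | _, _, .discard => simp [passiveActions]
  | _, _, .fetchDiscard => simp [passiveActions]
  | _, .keep, _ => simp [passiveActions] at hs
  | _, .fetchKeep, _ => simp [passiveActions] at hs
  | _, .idle, _ => simp [passiveActions] at hs
  | Sum.inl (τ, true), .discard, .keep =>
    simp only [relCost, relValue] at hg hg'
    have h1 := hlt τ
    have h2 := h.le_advantage τ
    have h3 := h'.nonpos τ
    have h4 := min_le_left (X.ageing * (τ : ℝ) + u τ) z
    have h5 := min_le_left (X.ageing * (τ : ℝ) + u' τ) z'
    linarith
  | Sum.inl (τ, true), .discard, .fetchKeep =>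
    simp only [relCost, relValue] at hg hg'
    have h1 := hlt 0
    have h4 := min_le_left (X.ageing * (τ : ℝ) + u' τ) z'
    have h5 := min_le_right (X.ageing * (τ : ℝ) + u τ) z
    have h6 := min_le_right (X.ageing * (τ : ℝ) + u' τ) z'
    have h7 := min_le_left (X.advantage c z u 0) 0
    have h8 := min_le_right (X.advantage c' z' u' 0) 0
    have h9 := h'.nonpos τ
    linarith
  | Sum.inl (τ, true), .fetchDiscard, .keep =>
    simp only [relCost, relValue] at hg hg'
    have h1 := hlt τ
    have h2 := h.le_advantage τ
    have h4 := min_le_left (X.ageing * (τ : ℝ) + u τ) z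
    have h6 := min_le_right (X.ageing * (τ : ℝ) + u' τ) z'
    have h8 := min_le_right (X.advantage c' z' u' 0) 0
    linarith
  | Sum.inl (τ, true), .fetchDiscard, .fetchKeep =>
    simp only [relCost, relValue] at hg hg'
    have h1 := hlt 0
    have h5 := min_le_right (X.ageing * (τ : ℝ) + u τ) z
    have h6 := min_le_right (X.ageing * (τ : ℝ) + u' τ) z'
    have h7 := min_le_left (X.advantage c z u 0) 0
    have h8 := min_le_right (X.advantage c' z' u' 0) 0
    linarith
  | Sum.inl (τ, false), .discard, .keep =>
    simp only [relCost, relValue] at hg hg'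
    have h1 := hlt τ
    have h2 := h.le_advantage τ
    have h3 := h'.nonpos τ
    linarith
  | Sum.inl (τ, false), .fetchDiscard, .keep => simp [admissible] at hm
  | Sum.inr true, .fetchDiscard, .fetchKeep =>
    simp only [relCost, relValue] at hg hg'
    have h1 := hlt 0
    have h7 := min_le_left (X.advantage c z u 0) 0
    have h8 := min_le_right (X.advantage c' z' u' 0) 0
    linarith
  | Sum.inr true, .discard, _ => simp [admissible] at hm
  | Sum.inr false, .discard, _ => simp [admissible] at hm
  | Sum.inr false, .fetchDiscard, _ => simp [admissible] at hm
  | Sum.inl (τ, true), _, .idle => simp [admissible] at hm'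
  | Sum.inl (τ, false), _, .fetchKeep => simp [admissible] at hm'
  | Sum.inl (τ, false), _, .idle => simp [admissible] at hm'
  | Sum.inr true, _, .keep => simp [admissible] at hm'
  | Sum.inr true, _, .idle => simp [admissible] at hm'

/-- The greedy action that keeps the content in case of a tie. -/
def greedyAct (X : Content) (c z : ℝ) (u : ℝ≥0 → ℝ) : State → Action
  | Sum.inl (τ, true) => if X.ageing * τ + u τ ≤ z then
      (if X.advantage c z u τ ≤ 0 then .keep else .discard) else
      (if X.advantage c z u 0 ≤ 0 then .fetchKeep else .fetchDiscard)
  | Sum.inl (τ, false) => if X.advantage c z u τ ≤ 0 then .keep else .discard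
  | Sum.inr true => if X.advantage c z u 0 ≤ 0 then .fetchKeep else .fetchDiscard
  | Sum.inr false => .idle

lemma measurable_greedyAct {c z : ℝ} {u : ℝ≥0 → ℝ} (hu : Measurable u) :
    Measurable (X.greedyAct c z u) := by
  have h1 : MeasurableSet {τ | X.advantage c z u τ ≤ 0} :=
    measurableSet_le (measurable_advantage hu) measurable_const
  refine measurable_fun_sum (measurable_from_prod_countable_left fun b => ?_) Measurable.of_discrete
  cases b
  · exact Measurable.ite h1 measurable_const measurable_const
  · refine Measurable.ite (measurableSet_le (by fun_prop) measurable_const)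
      (Measurable.ite h1 measurable_const measurable_const) measurable_const

/-- The stationary policy taking the greedy actions. -/
def greedyRule (X : Content) (c z : ℝ) {u : ℝ≥0 → ℝ} (hu : Measurable u) : DecisionRule where
  act := X.greedyAct c z u
  act_mem s := by
    match s with
    | Sum.inl (τ, true) => rw [greedyAct]; split_ifs <;> simp [admissible]
    | Sum.inl (τ, false) => rw [greedyAct]; split_ifs <;> simp [admissible]
    | Sum.inr true => rw [greedyAct]; split_ifs <;> simp [admissible]
    | Sum.inr false => simp [greedyAct, admissible]
  measurable_act := measurable_greedyAct hu

lemma isGreedy_greedyRule {c z : ℝ} {u : ℝ≥0 → ℝ} (h : X.IsReducedSolution c z u) :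
    X.IsGreedy c z u (X.greedyRule c z h.measurable) := by
  intro s
  have hz := h.fetch_eq_min
  have hu := h.eq_min
  change X.relCost c z u s (X.greedyAct c z u s) = _
  match s with
  | Sum.inl (τ, true) =>
    rw [greedyAct, relValue]
    split_ifs with h1 h2 h2
    · rw [min_eq_left h1, relCost, hu, min_eq_left h2]
    · rw [min_eq_left h1, relCost, hu, min_eq_right (not_le.1 h2).le, add_zero]
    · rw [min_eq_right (not_le.1 h1).le, relCost]
      rw [min_eq_left h2] at hz
      exact hz.symm
    · rw [min_eq_right (not_le.1 h1).le, relCost]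
      rw [min_eq_right (not_le.1 h2).le, add_zero] at hz
      exact hz.symm
  | Sum.inl (τ, false) =>
    rw [greedyAct, relValue]
    split_ifs with h2
    · rw [relCost, hu, min_eq_left h2]
    · rw [hu, min_eq_right (not_le.1 h2).le]
      rfl
  | Sum.inr true =>
    rw [greedyAct, relValue]
    split_ifs with h2
    · rw [min_eq_left h2] at hz
      exact hz.symm
    · rw [min_eq_right (not_le.1 h2).le, add_zero] at hz
      exact hz.symm
  | Sum.inr false => rfl

lemma greedyRule_mem_activeActions {z : ℝ} {u : ℝ≥0 → ℝ} (h : X.IsReducedSolution 0 z u)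
    {s : State} (hs : s ∈ actionStates) :
    (X.greedyRule 0 z h.measurable).act s ∈ activeActions := by
  change X.greedyAct 0 z u s ∈ _
  have hf := advantage_nonpos h
  match s with
  | Sum.inl (τ, true) => rw [greedyAct, if_pos (hf τ), if_pos (hf 0)]; split_ifs <;> simp [activeActions]
  | Sum.inl (τ, false) => rw [greedyAct, if_pos (hf τ)]; simp [activeActions]
  | Sum.inr true => rw [greedyAct, if_pos (hf 0)]; simp [activeActions]
  | Sum.inr false => exact absurd rfl hs

end Content

/-! ### The controlled process, drift inequalities and the number of epochs. -/

instance : Countable Action := by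
  refine (Function.Injective.countable (f := fun a : Action => a.ctorIdx) ?_ : Countable Action)
  intro a b h
  cases a <;> cases b <;> first | rfl | simp [Action.ctorIdx] at h

lemma measurable_next (a : Action) :
    Measurable fun q : State × (ℝ≥0 × Bool) => next q.1 a q.2 := by
  have h : Measurable fun q : ((ℝ≥0 × Bool) × (ℝ≥0 × Bool)) ⊕ (Bool × (ℝ≥0 × Bool)) =>
      next (Sum.map Prod.fst Prod.fst q) a (Sum.elim Prod.snd Prod.snd q) := by
    refine measurable_fun_sum ?_ ?_
    · cases a <;> simp only [Function.comp_def, Sum.map_inl, Sum.elim_inl, next] <;> fun_prop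
    · cases a <;> simp only [Function.comp_def, Sum.map_inr, Sum.elim_inr, next] <;> fun_prop
  convert! h.comp (MeasurableEquiv.sumProdDistrib (ℝ≥0 × Bool) Bool (ℝ≥0 × Bool)).measurable using 1
  ext1 ⟨q | q, x⟩ <;> rfl

lemma measurable_next_act (μ : DecisionRule) :
    Measurable fun q : State × (ℝ≥0 × Bool) => next q.1 (μ.act q.1) q.2 := by
  have h : Measurable fun q : Action × (State × (ℝ≥0 × Bool)) => next q.2.1 q.1 q.2.2 :=
    measurable_from_prod_countable_right measurable_next
  exact h.comp ((μ.measurable_act.comp measurable_fst).prodMk measurable_id)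

/-- The information available at the `k`-th request epoch. -/
abbrev past (k : ℕ) : MeasurableSpace (ℕ → ℝ≥0 × Bool) :=
  ⨆ j ∈ Set.Iio k, MeasurableSpace.comap (fun ω => ω j) inferInstance

lemma past_le (k : ℕ) : past k ≤ MeasurableSpace.pi :=
  iSup₂_le fun j _ => (measurable_pi_apply j).comap_le

lemma past_mono {k l : ℕ} (h : k ≤ l) : past k ≤ past l :=
  biSup_mono fun _ hj => lt_of_lt_of_le hj h

lemma measurable_past_apply (k : ℕ) : Measurable[past (k + 1)] fun ω : ℕ → ℝ≥0 × Bool => ω k := by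
  refine Measurable.mono (comap_measurable _) ?_ le_rfl
  exact le_iSup₂_of_le k (Nat.lt_succ_self k) le_rfl

lemma measurable_stateAt_past (π : ℕ → DecisionRule) (s : State) (k : ℕ) :
    Measurable[past k] fun ω => stateAt π s ω k := by
  induction k with
  | zero => exact measurable_const
  | succ k ih =>
    exact (measurable_next_act (π k)).comp
      ((ih.mono (past_mono k.le_succ) le_rfl).prodMk (measurable_past_apply k))

lemma epoch_succ (ω : ℕ → ℝ≥0 × Bool) (k : ℕ) : epoch ω (k + 1) = epoch ω k + (ω k).1 :=
  Finset.sum_range_succ _ _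

lemma measurable_epoch_past (k : ℕ) : Measurable[past k] fun ω => epoch ω k := by
  induction k with
  | zero => simp only [epoch, Finset.range_zero, Finset.sum_empty]; exact measurable_const
  | succ k ih =>
    simp only [epoch_succ]
    exact (ih.mono (past_mono k.le_succ) le_rfl).add
      ((by fun_prop : Measurable fun x : ℝ≥0 × Bool => (x.1 : ℝ)).comp (measurable_past_apply k))

lemma measurable_stateAt (π : ℕ → DecisionRule) (s : State) (k : ℕ) :
    Measurable fun ω => stateAt π s ω k :=
  (measurable_stateAt_past π s k).mono (past_le k) le_rfl

lemma measurable_epoch (k : ℕ) : Measurable fun ω => epoch ω k :=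
  (measurable_epoch_past k).mono (past_le k) le_rfl

lemma epoch_nonneg (ω : ℕ → ℝ≥0 × Bool) (k : ℕ) : 0 ≤ epoch ω k :=
  Finset.sum_nonneg fun j _ => (ω j).1.coe_nonneg

lemma sumUpTo_const_mul (ω : ℕ → ℝ≥0 × Bool) (T : ℝ) (r : ℝ≥0∞) :
    sumUpTo ω T (fun _ => r) = r * sumUpTo ω T fun _ => 1 := by
  rw [sumUpTo, sumUpTo, ← ENNReal.tsum_mul_left]
  refine tsum_congr fun k => ?_
  by_cases h : 1 ≤ k ∧ epoch ω k ≤ T <;> simp [h]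

lemma indicator_sumUpTo (ω : ℕ → ℝ≥0 × Bool) (T : ℝ) (f : ℕ → ℝ≥0∞) (k : ℕ) :
    Set.indicator {k | 1 ≤ k ∧ epoch ω k ≤ T} f k =
      if 1 ≤ k then Set.indicator {ω | epoch ω k ≤ T} (fun _ => f k) ω else 0 := by
  by_cases h : 1 ≤ k <;> by_cases h' : epoch ω k ≤ T <;> simp [h, h']

namespace Content

variable {X : Content}

instance : IsProbabilityMeasure X.law := by
  unfold law
  infer_instance

/-- The Markov property in integrated form: the k-th noise is independent of the information `past
k`, so it can be integrated out separately. -/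
lemma lintegral_past {Y : Type*} [MeasurableSpace Y] (k : ℕ) {Φ : (ℕ → ℝ≥0 × Bool) → Y}
    (hΦ : Measurable[past k] Φ) {G : Y × (ℝ≥0 × Bool) → ℝ≥0∞} (hG : Measurable G) :
    ∫⁻ ω, G (Φ ω, ω k) ∂X.law = ∫⁻ ω, ∫⁻ x, G (Φ ω, x) ∂X.noise ∂X.law := by
  have hΦ' : Measurable Φ := hΦ.mono (past_le k) le_rfl
  have hk : Measurable fun ω : ℕ → ℝ≥0 × Bool => ω k := measurable_pi_apply k
  have hmap : X.law.map (fun ω => ω k) = X.noise :=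
    Measure.infinitePi_map_eval (fun _ => X.noise) k
  have h1 : iIndepFun (fun (j : ℕ) (ω : ℕ → ℝ≥0 × Bool) => ω j) X.law :=
    iIndepFun_infinitePi (P := fun _ => X.noise) (X := fun _ x => x) fun _ => measurable_id
  have h2 : Indep (past k) (⨆ j ∈ ({k} : Set ℕ), MeasurableSpace.comap
      (fun ω : ℕ → ℝ≥0 × Bool => ω j) inferInstance) X.law :=
    indep_iSup_of_disjoint (fun j => (measurable_pi_apply j).comap_le) h1 (by simp)
  rw [iSup_singleton] at h2
  have h3 : IndepFun Φ (fun ω => ω k) X.law := indep_of_indep_of_le_left h2 hΦ.comap_le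
  rw [indepFun_iff_map_prod_eq_prod_map_map hΦ'.aemeasurable hk.aemeasurable, hmap] at h3
  have : IsProbabilityMeasure (X.law.map Φ) := Measure.isProbabilityMeasure_map hΦ'.aemeasurable
  rw [← lintegral_map hG (hΦ'.prodMk hk), h3, lintegral_prod _ hG.aemeasurable,
    lintegral_map hG.lintegral_prod_right' hΦ']

lemma lintegral_sumUpTo (T : ℝ) {f : ℕ → (ℕ → ℝ≥0 × Bool) → ℝ≥0∞} (hf : ∀ k, Measurable (f k)) :
    ∫⁻ ω, sumUpTo ω T (fun k => f k ω) ∂X.law =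
      ∑' k, if 1 ≤ k then ∫⁻ ω in {ω | epoch ω k ≤ T}, f k ω ∂X.law else 0 := by
  have hT : ∀ k, MeasurableSet {ω | epoch ω k ≤ T} := fun k =>
    measurableSet_le (measurable_epoch k) measurable_const
  have h : ∀ ω, sumUpTo ω T (fun k => f k ω) =
      ∑' k, if 1 ≤ k then Set.indicator {ω | epoch ω k ≤ T} (f k) ω else 0 := fun ω => by
    rw [sumUpTo]
    refine tsum_congr fun k => ?_
    rw [indicator_sumUpTo]
    rfl
  simp_rw [h]
  rw [lintegral_tsum fun k => ?_]
  · refine tsum_congr fun k => ?_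
    split_ifs
    · rw [lintegral_indicator (hT k)]
    · simp
  · split_ifs
    · exact ((hf k).indicator (hT k)).aemeasurable
    · exact aemeasurable_const

/-- A drift inequality for the controlled process bounds the expected sum of the stage costs `x` up
to time `T` by that of the stage costs `y`, up to the bound of the potential `H`. -/
lemma lintegral_sumUpTo_le_of_drift (π : ℕ → DecisionRule) (s : State) (T : ℝ)
    {x y : ℕ → State → ℝ≥0∞} (hx : ∀ k, Measurable (x k)) (hy : ∀ k, Measurable (y k))
    {H : State × ℝ → ℝ≥0∞} (hH : Measurable H) {K : ℝ≥0∞} (hK : ∀ s t, 0 ≤ t → H (s, t) ≤ K)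
    (hd : ∀ k s t, t ≤ T → x k s + ∫⁻ ξ, H (next s ((π k).act s) ξ, t + ξ.1) ∂X.noise ≤
      y k s + H (s, t)) :
    ∫⁻ ω, sumUpTo ω T (fun k => x k (stateAt π s ω k)) ∂X.law ≤
      ∫⁻ ω, sumUpTo ω T (fun k => y k (stateAt π s ω k)) ∂X.law + K := by
  have hxm : ∀ k, Measurable fun ω => x k (stateAt π s ω k) := fun k =>
    (hx k).comp (measurable_stateAt π s k)
  have hym : ∀ k, Measurable fun ω => y k (stateAt π s ω k) := fun k =>
    (hy k).comp (measurable_stateAt π s k)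
  have hHm : ∀ k, Measurable fun ω => H (stateAt π s ω k, epoch ω k) := fun k =>
    hH.comp ((measurable_stateAt π s k).prodMk (measurable_epoch k))
  have hT : ∀ k, MeasurableSet {ω | epoch ω k ≤ T} := fun k =>
    measurableSet_le (measurable_epoch k) measurable_const
  rw [lintegral_sumUpTo T hxm, lintegral_sumUpTo T hym]
  set a : ℕ → ℝ≥0∞ := fun k => if 1 ≤ k then
    ∫⁻ ω in {ω | epoch ω k ≤ T}, x k (stateAt π s ω k) ∂X.law else 0
  set b : ℕ → ℝ≥0∞ := fun k => if 1 ≤ k then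
    ∫⁻ ω in {ω | epoch ω k ≤ T}, y k (stateAt π s ω k) ∂X.law else 0
  set V : ℕ → ℝ≥0∞ := fun k => ∫⁻ ω in {ω | epoch ω k ≤ T}, H (stateAt π s ω k, epoch ω k) ∂X.law
  have hV1 : V 1 ≤ K := by
    calc V 1 ≤ ∫⁻ ω in {ω | epoch ω 1 ≤ T}, K ∂X.law :=
          lintegral_mono fun ω => hK _ _ (epoch_nonneg ω 1)
      _ = K * X.law {ω | epoch ω 1 ≤ T} := setLIntegral_const _ _
      _ ≤ K := mul_le_of_le_one_right' prob_le_one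
  have hstep : ∀ k, 1 ≤ k → a k + V (k + 1) ≤ b k + V k := by
    intro k hk
    set G : (State × ℝ) × (ℝ≥0 × Bool) → ℝ≥0∞ := fun q =>
      Set.indicator {q | q.1.2 ≤ T}
        (fun q => H (next q.1.1 ((π k).act q.1.1) q.2, q.1.2 + q.2.1)) q
    have hG : Measurable G := by
      refine Measurable.indicator (hH.comp (Measurable.prodMk ?_ (by fun_prop)))
        (measurableSet_le (by fun_prop) measurable_const)
      exact (measurable_next_act (π k)).comp
        ((measurable_fst.comp measurable_fst).prodMk measurable_snd)
    have h1 : V (k + 1) ≤ ∫⁻ ω in {ω | epoch ω k ≤ T},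
        ∫⁻ ξ, H (next (stateAt π s ω k) ((π k).act (stateAt π s ω k)) ξ, epoch ω k + ξ.1)
          ∂X.noise ∂X.law := by
      calc V (k + 1) ≤ ∫⁻ ω in {ω | epoch ω k ≤ T}, H (stateAt π s ω (k + 1), epoch ω (k + 1))
            ∂X.law := by
            -- The event t_{k+1} ≤ T is enlarged to t_k ≤ T inside the integral of H ≥ 0. The larger
            -- event belongs to `past k`, so the k-th noise can be integrated out.
            refine lintegral_mono_set fun ω hω => ?_
            have h2 : epoch ω (k + 1) ≤ T := hω
            rw [epoch_succ] at h2
            have := (ω k).1.coe_nonneg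
            change epoch ω k ≤ T
            linarith
        _ = ∫⁻ ω, G ((stateAt π s ω k, epoch ω k), ω k) ∂X.law := by
            rw [← lintegral_indicator (hT k)]
            refine lintegral_congr fun ω => ?_
            simp only [G, Set.indicator_apply, Set.mem_ofPred_eq, stateAt, epoch_succ]
        _ = ∫⁻ ω, ∫⁻ ξ, G ((stateAt π s ω k, epoch ω k), ξ) ∂X.noise ∂X.law :=
            lintegral_past k ((measurable_stateAt_past π s k).prodMk (measurable_epoch_past k)) hG
        _ = _ := by
            rw [← lintegral_indicator (hT k)]
            refine lintegral_congr fun ω => ?_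
            by_cases h : epoch ω k ≤ T <;> simp [G, h]
    simp only [a, b, hk, if_true]
    refine (add_le_add le_rfl h1).trans ?_
    rw [← lintegral_add_left (hxm k), ← lintegral_add_left (hym k)]
    exact setLIntegral_mono ((hym k).add (hHm k)) fun ω hω => hd k _ _ hω
  have hsum : ∀ n, ∑ k ∈ Finset.range (n + 1), a k + V (n + 1) ≤
      ∑ k ∈ Finset.range (n + 1), b k + V 1 := by
    intro n
    induction n with
    | zero => simp [a, b]
    | succ n ih =>
      rw [Finset.sum_range_succ, Finset.sum_range_succ b]
      calc ∑ k ∈ Finset.range (n + 1), a k + a (n + 1) + V (n + 1 + 1)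
          = ∑ k ∈ Finset.range (n + 1), a k + (a (n + 1) + V (n + 1 + 1)) := by rw [add_assoc]
        _ ≤ ∑ k ∈ Finset.range (n + 1), a k + (b (n + 1) + V (n + 1)) := by
            exact add_le_add le_rfl (hstep (n + 1) (by omega))
        _ = (∑ k ∈ Finset.range (n + 1), a k + V (n + 1)) + b (n + 1) := by
            rw [add_comm (b (n + 1)), add_assoc]
        _ ≤ (∑ k ∈ Finset.range (n + 1), b k + V 1) + b (n + 1) := by gcongr
        _ = _ := by rw [add_right_comm]
  refine ENNReal.tsum_le_of_sum_range_le fun n => ?_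
  calc ∑ k ∈ Finset.range n, a k ≤ ∑ k ∈ Finset.range (n + 1), a k :=
        Finset.sum_le_sum_of_subset (Finset.range_mono n.le_succ)
    _ ≤ ∑ k ∈ Finset.range (n + 1), a k + V (n + 1) := le_self_add
    _ ≤ ∑ k ∈ Finset.range (n + 1), b k + V 1 := hsum n
    _ ≤ _ := add_le_add (ENNReal.sum_le_tsum _) hV1

/-- The expected number of request epochs up to time `T` is finite. -/
lemma lintegral_sumUpTo_one_ne_top (T : ℝ) : ∫⁻ ω, sumUpTo ω T (fun _ => 1) ∂X.law ≠ ∞ := by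
  set r := ∫⁻ x, ENNReal.ofReal (Real.exp (-(x : ℝ))) ∂X.gap
  have hr : r < 1 := X.lintegral_exp_neg_lt_one
  set R := (1 - r)⁻¹
  have hR : R ≠ ∞ := ENNReal.inv_ne_top.2 (tsub_pos_of_lt hr).ne'
  have hR1 : 1 + r * R = R := by
    have h : (1 - r) * R = 1 := ENNReal.mul_inv_cancel (tsub_pos_of_lt hr).ne' (by simp)
    nth_rw 1 [← h]
    rw [← add_mul, tsub_add_cancel_of_le hr.le, one_mul]
  -- Any policy would do here; the epochs do not depend on it. The potential exp(T - t) R with R = 1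
  -- + r R pays one unit at each epoch up to T.
  obtain ⟨z, u, hu⟩ := exists_isReducedSolution (X := X) (le_refl (0 : ℝ))
  have h := lintegral_sumUpTo_le_of_drift (X := X) (fun _ => X.greedyRule 0 z hu.measurable)
    (Sum.inr false) T (x := fun _ _ => 1) (y := fun _ _ => 0) (fun _ => measurable_const)
    (fun _ => measurable_const) (H := fun q => ENNReal.ofReal (Real.exp (T - q.2)) * R)
    (by fun_prop) (K := ENNReal.ofReal (Real.exp T) * R)
    (fun s t ht => by gcongr; linarith) (fun k s t ht => ?_)
  · refine ne_top_of_le_ne_top ?_ h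
    have : ∀ ω, sumUpTo ω T (fun _ => 0) = 0 := fun ω => by simp [sumUpTo]
    simp only [this, lintegral_zero, zero_add]
    exact ENNReal.mul_ne_top ENNReal.ofReal_ne_top hR
  · have h1 : ∀ ξ : ℝ≥0 × Bool, ENNReal.ofReal (Real.exp (T - (t + ξ.1))) * R =
        ENNReal.ofReal (Real.exp (T - t)) * R * ENNReal.ofReal (Real.exp (-(ξ.1 : ℝ))) := fun ξ => by
      rw [show T - (t + ξ.1) = (T - t) + -(ξ.1 : ℝ) by ring, Real.exp_add,
        ENNReal.ofReal_mul (Real.exp_pos _).le]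
      ring
    have h2 : (1 : ℝ≥0∞) ≤ ENNReal.ofReal (Real.exp (T - t)) := by
      rw [ENNReal.one_le_ofReal, Real.one_le_exp_iff]
      linarith
    simp only [h1]
    rw [lintegral_const_mul _ (by fun_prop),
      X.lintegral_noise_fst (F := fun x => ENNReal.ofReal (Real.exp (-(x : ℝ)))) (by fun_prop), zero_add]
    calc 1 + ENNReal.ofReal (Real.exp (T - t)) * R * r
        ≤ ENNReal.ofReal (Real.exp (T - t)) + ENNReal.ofReal (Real.exp (T - t)) * R * r := by gcongr
      _ = ENNReal.ofReal (Real.exp (T - t)) * (1 + r * R) := by ring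
      _ = _ := by rw [hR1]

/-- The expected number of request epochs tends to infinity. -/
lemma tendsto_lintegral_sumUpTo_one :
    Tendsto (fun T => ∫⁻ ω, sumUpTo ω T (fun _ => 1) ∂X.law) atTop (nhds ∞) := by
  have h1 : ∀ k, Tendsto (fun T : ℝ => X.law {ω | epoch ω k ≤ T}) atTop (nhds 1) := fun k => by
    have h2 := tendsto_measure_iUnion_atTop (μ := X.law) (s := fun T : ℝ => {ω | epoch ω k ≤ T})
      fun T T' hT ω hω => le_trans hω hT
    have h3 : ⋃ T : ℝ, {ω | epoch ω k ≤ T} = Set.univ :=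
      Set.eq_univ_of_forall fun ω => Set.mem_iUnion.2 ⟨epoch ω k, le_refl (epoch ω k)⟩
    rwa [h3, measure_univ] at h2
  refine ENNReal.tendsto_nhds_top fun n => ?_
  have h4 : Tendsto (fun T : ℝ => ∑ k ∈ Finset.Icc 1 (n + 1), X.law {ω | epoch ω k ≤ T}) atTop
      (nhds (∑ k ∈ Finset.Icc 1 (n + 1), 1)) := tendsto_finsetSum _ fun k _ => h1 k
  have h5 : (n : ℝ≥0∞) < ∑ k ∈ Finset.Icc 1 (n + 1), 1 := by
    simp only [Finset.sum_const, Nat.card_Icc, nsmul_eq_mul, mul_one]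
    exact_mod_cast (by omega : n < n + 1 + 1 - 1)
  filter_upwards [h4.eventually (lt_mem_nhds h5)] with T hT
  refine hT.trans_le ?_
  rw [lintegral_sumUpTo T (f := fun _ _ => 1) fun _ => measurable_const]
  refine le_trans (Finset.sum_le_sum fun k hk => ?_)
    (ENNReal.sum_le_tsum (Finset.Icc 1 (n + 1)))
  simp [(Finset.mem_Icc.1 hk).1]

end Content

/-! ### Verification of optimality and indexability. -/

namespace Content

variable {X : Content}

lemma cost_nonneg {Ch : ℝ} (hCh : 0 ≤ Ch) (s : State) (a : Action) : 0 ≤ X.cost Ch s a := by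
  have h1 : 0 ≤ Ch / X.β := div_nonneg hCh X.β_pos.le
  have h2 := X.cf_pos.le
  have h3 : ∀ τ : ℝ≥0, 0 ≤ X.ca * X.lam * τ := fun τ => mul_nonneg X.ageing_nonneg τ.coe_nonneg
  unfold cost
  split
  · exact add_nonneg (h3 _) h1
  · exact add_nonneg h2 h1
  · exact h3 _
  · exact h2
  · exact h1
  · exact add_nonneg h2 h1
  · exact h2
  · exact le_rfl

lemma measurable_cost (Ch : ℝ) (μ : DecisionRule) : Measurable fun s => X.cost Ch s (μ.act s) := by
  have h : Measurable fun q : Action × State => X.cost Ch q.2 q.1 := by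
    refine measurable_from_prod_countable_right fun a => ?_
    refine measurable_fun_sum (measurable_from_prod_countable_left fun b => ?_) Measurable.of_discrete
    cases a <;> cases b <;> simp only [Function.comp_def, cost] <;> fun_prop
  exact h.comp (μ.measurable_act.prodMk measurable_id)

lemma lintegral_ofReal_next {h : State → ℝ} (hm : Measurable h) {B : ℝ} (hB : ∀ s, |h s| ≤ B)
    (h0 : ∀ s, 0 ≤ h s) (μ : DecisionRule) (s : State) :
    ∫⁻ ξ, ENNReal.ofReal (h (next s (μ.act s) ξ)) ∂X.noise =
      ENNReal.ofReal (∫ ξ, h (next s (μ.act s) ξ) ∂X.noise) :=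
  (ofReal_integral_eq_lintegral_ofReal
    (X.integrable_noise (hm.comp ((measurable_next_act μ).comp measurable_prodMk_left)) fun _ => hB _)
    (.of_forall fun _ => h0 _)).symm

lemma integrable_next {h : State → ℝ} (hm : Measurable h) {B : ℝ} (hB : ∀ s, |h s| ≤ B)
    (μ : DecisionRule) (s : State) : Integrable (fun ξ => h (next s (μ.act s) ξ)) X.noise :=
  X.integrable_noise (hm.comp ((measurable_next_act μ).comp measurable_prodMk_left)) fun _ => hB _

lemma tendsto_div_lintegral_sumUpTo_one {K : ℝ≥0∞} (hK : K ≠ ∞) :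
    Tendsto (fun T => K / ∫⁻ ω, sumUpTo ω T (fun _ => 1) ∂X.law) atTop (nhds 0) := by
  have h := ENNReal.Tendsto.const_div (a := K) (tendsto_lintegral_sumUpTo_one (X := X)) (Or.inr hK)
  simpa using h

lemma eventually_lintegral_sumUpTo_one_ne_zero :
    ∀ᶠ T in atTop, ∫⁻ ω, sumUpTo ω T (fun _ => 1) ∂X.law ≠ 0 :=
  (tendsto_lintegral_sumUpTo_one (X := X)).eventually_ne (by simp)

/-- No policy has a lower average cost than the one given by a solution of Bellman's equation. -/
lemma IsBellmanSolution.le_avgCost {Ch θ : ℝ} {h : State → ℝ} (hb : X.IsBellmanSolution Ch θ h)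
    (hCh : 0 ≤ Ch) (hθ : 0 ≤ θ / X.β) (π : ℕ → DecisionRule) (s : State) :
    ENNReal.ofReal (θ / X.β) ≤ X.avgCost Ch π s := by
  obtain ⟨hm, ⟨B, hB⟩, hl⟩ := hb
  -- Potentials take values in `ℝ≥0∞`, so -h is shifted by B. The boundary term is then at most 2B
  -- and vanishes after division by E[A(T)].
  have hBs : ∀ s, 0 ≤ B - h s := fun s => by linarith [(abs_le.1 (hB s)).2]
  have hBs' : ∀ s, |B - h s| ≤ 2 * B := fun s => by
    rw [abs_of_nonneg (hBs s)]
    linarith [(abs_le.1 (hB s)).1]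
  have key : ∀ T, ENNReal.ofReal (θ / X.β) * ∫⁻ ω, sumUpTo ω T (fun _ => 1) ∂X.law ≤
      ∫⁻ ω, sumUpTo ω T (fun k => ENNReal.ofReal (X.cost Ch (stateAt π s ω k)
        ((π k).act (stateAt π s ω k)))) ∂X.law + ENNReal.ofReal (2 * B) := fun T => by
    have h1 := lintegral_sumUpTo_le_of_drift (X := X) π s T
      (x := fun _ _ => ENNReal.ofReal (θ / X.β))
      (y := fun k s => ENNReal.ofReal (X.cost Ch s ((π k).act s))) (fun _ => measurable_const)
      (fun k => (measurable_cost Ch (π k)).ennreal_ofReal)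
      (H := fun q => ENNReal.ofReal (B - h q.1)) (by fun_prop) (K := ENNReal.ofReal (2 * B))
      (fun s t _ => ENNReal.ofReal_le_ofReal ((le_abs_self _).trans (hBs' s)))
      (fun k s t _ => ?_)
    · simp_rw [sumUpTo_const_mul _ _ (ENNReal.ofReal (θ / X.β))] at h1
      rwa [lintegral_const_mul' _ _ ENNReal.ofReal_ne_top] at h1
    · dsimp only
      rw [lintegral_ofReal_next (h := fun s => B - h s) (by fun_prop) hBs' hBs,
        ← ENNReal.ofReal_add hθ (integral_nonneg fun _ => hBs _),
        ← ENNReal.ofReal_add (cost_nonneg hCh _ _) (hBs s),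
        integral_sub (integrable_const _) (integrable_next hm hB (π k) s)]
      refine ENNReal.ofReal_le_ofReal ?_
      have h2 := (hl s).2 ⟨_, (π k).act_mem s, rfl⟩
      rw [bellmanValue] at h2
      simp only [integral_const, probReal_univ, smul_eq_mul, one_mul]
      linarith
  have hlim := ENNReal.Tendsto.sub (tendsto_const_nhds (x := ENNReal.ofReal (θ / X.β)))
    (tendsto_div_lintegral_sumUpTo_one (X := X) (K := ENNReal.ofReal (2 * B)) ENNReal.ofReal_ne_top)
    (Or.inr (by simp))
  rw [tsub_zero] at hlim
  rw [← hlim.limsup_eq]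
  refine limsup_le_limsup ?_
  filter_upwards [eventually_lintegral_sumUpTo_one_ne_zero (X := X)] with T hT
  rw [tsub_le_iff_right, ← ENNReal.add_div,
    ENNReal.le_div_iff_mul_le (Or.inl hT) (Or.inl (lintegral_sumUpTo_one_ne_top T))]
  exact key T

/-- A policy that takes the minimizing actions in Bellman's equation attains the average cost given
by the solution of this equation. -/
lemma IsBellmanSolution.avgCost_le {Ch θ : ℝ} {h : State → ℝ} (hb : X.IsBellmanSolution Ch θ h)
    (hCh : 0 ≤ Ch) (hθ : 0 ≤ θ / X.β) {μ : DecisionRule}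
    (hμ : ∀ s, X.bellmanValue Ch θ h s (μ.act s) = h s) (s : State) :
    X.avgCost Ch (fun _ => μ) s ≤ ENNReal.ofReal (θ / X.β) := by
  obtain ⟨hm, ⟨B, hB⟩, -⟩ := hb
  have hBs : ∀ s, 0 ≤ B + h s := fun s => by linarith [(abs_le.1 (hB s)).1]
  have hBs' : ∀ s, |B + h s| ≤ 2 * B := fun s => by
    rw [abs_of_nonneg (hBs s)]
    linarith [(abs_le.1 (hB s)).2]
  have key : ∀ T, ∫⁻ ω, sumUpTo ω T (fun k => ENNReal.ofReal (X.cost Ch (stateAt (fun _ => μ) s ω k)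
        (μ.act (stateAt (fun _ => μ) s ω k)))) ∂X.law ≤
      ENNReal.ofReal (θ / X.β) * ∫⁻ ω, sumUpTo ω T (fun _ => 1) ∂X.law +
        ENNReal.ofReal (2 * B) := fun T => by
    have h1 := lintegral_sumUpTo_le_of_drift (X := X) (fun _ => μ) s T
      (x := fun _ s => ENNReal.ofReal (X.cost Ch s (μ.act s)))
      (y := fun _ _ => ENNReal.ofReal (θ / X.β))
      (fun _ => (measurable_cost Ch μ).ennreal_ofReal) (fun _ => measurable_const)
      (H := fun q => ENNReal.ofReal (B + h q.1)) (by fun_prop) (K := ENNReal.ofReal (2 * B))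
      (fun s t _ => ENNReal.ofReal_le_ofReal ((le_abs_self _).trans (hBs' s)))
      (fun k s t _ => ?_)
    · simp_rw [sumUpTo_const_mul _ _ (ENNReal.ofReal (θ / X.β))] at h1
      rwa [lintegral_const_mul' _ _ ENNReal.ofReal_ne_top] at h1
    · dsimp only
      rw [lintegral_ofReal_next (h := fun s => B + h s) (by fun_prop) hBs' hBs,
        ← ENNReal.ofReal_add (cost_nonneg hCh _ _) (integral_nonneg fun _ => hBs _),
        ← ENNReal.ofReal_add hθ (hBs s),
        integral_add (integrable_const _) (integrable_next hm hB μ s)]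
      refine ENNReal.ofReal_le_ofReal ?_
      have h2 := hμ s
      rw [bellmanValue] at h2
      simp only [integral_const, probReal_univ, smul_eq_mul, one_mul]
      linarith
  have hlim := (tendsto_const_nhds (x := ENNReal.ofReal (θ / X.β))).add
    (tendsto_div_lintegral_sumUpTo_one (X := X) (K := ENNReal.ofReal (2 * B)) ENNReal.ofReal_ne_top)
  rw [add_zero] at hlim
  rw [← hlim.limsup_eq]
  refine limsup_le_limsup ?_
  filter_upwards [eventually_lintegral_sumUpTo_one_ne_zero (X := X)] with T hT
  have hT' := lintegral_sumUpTo_one_ne_top (X := X) T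
  refine ENNReal.div_le_of_le_mul ((key T).trans ?_)
  rw [add_mul, ENNReal.div_mul_cancel hT hT']

lemma isOptimalPolicy_of_isGreedy {Ch z : ℝ} (hCh : 0 ≤ Ch) {u : ℝ≥0 → ℝ}
    (h : X.IsReducedSolution (Ch / X.β) z u) {μ : DecisionRule}
    (hμ : X.IsGreedy (Ch / X.β) z u μ) : X.IsOptimalPolicy Ch μ := by
  obtain ⟨B, hB⟩ := h.bounded
  have hb := isBellmanSolution_relValue h
  have hθ : X.β * (X.p * z) / X.β = X.p * z := mul_div_cancel_left₀ _ X.β_pos.ne'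
  have hθ0 : 0 ≤ X.β * (X.p * z) / X.β := by
    rw [hθ]
    exact mul_nonneg X.p_pos.le (h.fetch_nonneg (div_nonneg hCh X.β_pos.le))
  have hv : ∀ s, X.bellmanValue Ch (X.β * (X.p * z)) (X.relValue z u) s (μ.act s) =
      X.relValue z u s := fun s => by
    rw [bellmanValue_eq (k := 0) h.measurable hB (by simp) hθ (μ.act_mem s), zero_add, hμ s]
  refine ⟨fun s => le_antisymm ?_ (iInf_le _ _), _, _, hb, hv⟩
  exact le_iInf fun π => (hb.avgCost_le hCh hθ0 hv s).trans (hb.le_avgCost hCh hθ0 π s)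

lemma exists_isOptimalFamily (X : Content) : ∃ μ : ℝ → DecisionRule, X.IsOptimalFamily μ := by
  have h1 : ∀ Ch : ℝ, ∃ μ : DecisionRule, 0 ≤ Ch → X.IsOptimalPolicy Ch μ ∧
      (Ch = 0 → ∀ s ∈ actionStates, μ.act s ∈ activeActions) := fun Ch => by
    -- The family is indexed by all reals; truncation at 0 gives a rule for negative holding costs
    -- too.
    obtain ⟨z, u, h⟩ := exists_isReducedSolution (X := X)
      (show 0 ≤ max Ch 0 / X.β from div_nonneg (le_max_right _ _) X.β_pos.le)
    refine ⟨X.greedyRule (max Ch 0 / X.β) z h.measurable, fun hCh => ?_⟩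
    have hg := isGreedy_greedyRule h
    constructor
    · revert hg h
      rw [max_eq_left hCh]
      exact fun h hg => isOptimalPolicy_of_isGreedy hCh h hg
    · rintro rfl s hs
      have h2 : max (0 : ℝ) 0 / X.β = 0 := by simp
      revert h
      rw [h2]
      exact fun h _ => greedyRule_mem_activeActions h hs
  choose μ hμ using h1
  refine ⟨μ, fun Ch hCh => (hμ Ch hCh).1, fun s hs => (hμ 0 le_rfl).2 rfl s ?_⟩
  rintro rfl
  obtain ⟨a, ha, ha', -⟩ := hs
  simp only [admissible, Set.mem_singleton_iff] at ha'
  simp [activeActions, ha'] at ha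

/-- The single-content problem is indexable. -/
lemma indexable (X : Content) : X.Indexable := by
  refine ⟨X.exists_isOptimalFamily, fun μ hμ => ⟨passiveSet_zero_eq_empty hμ, ?_, ?_⟩⟩
  · have hpos := mul_pos X.β_pos (mul_pos X.p_pos X.cf_pos)
    -- This threshold is C_h/β > p c_f; the added 1 makes it strict.
    refine ⟨X.β * (X.p * X.cf) + 1, by linarith, fun Ch hCh => ?_⟩
    obtain ⟨z, u, h, hg⟩ := (hμ.1 Ch (by linarith)).exists_greedy
    refine hg.passiveSet_eq h ?_
    rw [lt_div_iff₀ X.β_pos]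
    linarith
  · intro C₁ C₂ h₁ h₁₂
    rcases h₁₂.eq_or_lt with rfl | hlt
    · exact subset_rfl
    · obtain ⟨z, u, h, hg⟩ := (hμ.1 C₁ h₁).exists_greedy
      obtain ⟨z', u', h', hg'⟩ := (hμ.1 C₂ (h₁.trans h₁₂)).exists_greedy
      exact hg.passiveSet_subset h h' hg' (div_nonneg h₁ X.β_pos.le)
        (div_lt_div_of_pos_right hlt X.β_pos)

end Content
end Caching

end

theorem theorem2 :
    (∀ X : Caching.Content, X.Indexable) ∧
      (∀ (N M : ℕ) (R : Caching.CachingRMAB N M), R.Indexable) :=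
  ⟨fun X => X.indexable, fun _ _ R n => (R.content n).indexable⟩
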